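/- Let $\kappa$ be a strongly inaccessible cardinal and let $h:\kappa\to\kappa$ be an increasing (i.e. $h(\alpha)\le h(\beta)$ for $\alpha\le\beta$) function with range cofinal in $\kappa$ all of whose values are cardinals; call such a function an increasing cofinal cardinal function. For a tree $T\subseteq{}^{<\kappa}\kappa$ (a set closed under initial segments) and $u\in T$ let $\mathrm{suc}(u,T)$ be the set of immediate successors of $u$ in $T$. The node $u$ is splitting if $|\mathrm{suc}(u,T)|\ge 2$, and $u\in\mathrm{Split}_\alpha(T)$ if $u$ is splitting and the set of $\beta<\mathrm{length}(u)$ such that $u\restriction\beta$ is splitting has order type $\alpha$. The conditions of the forcing $\mathbb S^h_\kappa$ are the nonempty trees $T\subseteq{}^{<\kappa}\kappa$ such that (i) every $u\in T$ is extended by a splitting node of $T$; (ii) $|\mathrm{suc}(u,T)|\ge h(\alpha)$ for every $u\in\mathrm{Split}_\alpha(T)$; (iii) the union of every increasing sequence $\langle u_\alpha\mid\alpha<\gamma\rangle$, $0<\gamma<\kappa$, of splitting nodes of $T$ is a splitting node of $T$. The order is: $T\le S$ ($T$ is stronger) iff $T\subseteq S$ and, for every splitting node $u$ of $T$, either $\mathrm{suc}(u,T)=\mathrm{suc}(u,S)$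 or $|\mathrm{suc}(u,T)|<|\mathrm{suc}(u,S)|$. For $F:\kappa\to\kappa$ with cardinal values, an $F$-slalom is a function $\phi:\kappa\to[\kappa]^{<\kappa}$ with $|\phi(\alpha)|\le F(\alpha)$ for all $\alpha<\kappa$. A forcing notion $\mathbb P$ has the generalised $F$-Sacks property if for every $\mathbb P$-name $\dot f$ and every $p\in\mathbb P$ with $p\Vdash\dot f:\check\kappa\to\check\kappa$ there are an $F$-slalom $\phi$ and $q\le p$ such that $q\Vdash\dot f(\check\alpha)\in\check\phi(\check\alpha)$ for all $\alpha<\kappa$. Then: (1) There is an increasing cofinal cardinal function $F:\kappa\to\kappa$ with $h(\alpha)\le F(\alpha)$ for all $\alpha<\kappa$ such that $\mathbb S^h_\kappa$ has the generalised $F$-Sacks property. (2) If $h(\alpha)\ne 0$ for all $0<\alpha<\kappa$, then $F(\alpha)=h(\alpha)^{|\alpha|}$ defines an increasing cofinal cardinal function $F:\kappa\to\kappa$ with $h(\alpha)\le F(\alpha)$ for all $0<\alpha<\kappa$, and $\mathbb S^h_\kappa$ has the generalised $F$-Sacks property for this $F$. (3) $\mathbb S^h_\kappa$ preserves $\kappa^+$,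 i.e. every condition forces that $\kappa^+$ is still a cardinal. -/

import Mathlib

universe u

namespace TreeForcing

open Cardinal

/-! ### Names, the forcing language and the forcing relation -/

section Names

/-- `P`-names for a forcing notion `P`: a name is a set of pairs (name, condition). -/
inductive PName (P : Type u) : Type (u + 1)
  | mk (ι : Type u) (cond : ι → P) (name : ι → PName P) : PName P

/-- The canonical name of a ground model set: it consists of all pairs (canonical name of `y`, `p`)
with `y` an element of the set and `p` any condition (no largest condition is presupposed). -/
def PName.check (P : Type u) : PSet.{u} → PName P
  | ⟨ι, A⟩ => .mk (ι × P) (fun x => x.2) (fun x => PName.check P (A x.1))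

/-- The canonical name for the unordered pair of `a` and `b`. -/
def PName.upair {P : Type u} (a b : PName P) : PName P :=
  .mk (ULift.{u} Bool × P) (fun x => x.2) (fun x => bif x.1.down then a else b)

/-- The canonical name for the (Kuratowski) ordered pair of `a` and `b`. -/
def PName.opair {P : Type u} (a b : PName P) : PName P :=
  .upair (.upair a a) (.upair a b)

/-- The forcing language: formulas of set theory with names as parameters; a quantifier over names
is given by the family of its instances. -/
inductive Fml (P : Type u) : Type (u + 1)
  | eq (a b : PName P) : Fml P
  | mem (a b : PName P) : Fml P
  | neg (φ : Fml P) : Fml P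
  | and (φ ψ : Fml P) : Fml P
  | all (φ : PName P → Fml P) : Fml P

namespace Fml

variable {P : Type u}

/-- Implication. -/
def imp (φ ψ : Fml P) : Fml P := neg (and φ (neg ψ))

/-- Existential quantification. -/
def ex (φ : PName P → Fml P) : Fml P := neg (all fun x => neg (φ x))

/-- "`f` is a function from `A` to `B`". -/
def isFun (f A B : PName P) : Fml P :=
  and (all fun x => imp (mem x f)
        (ex fun a => ex fun b => and (mem a A) (and (mem b B) (eq x (.opair a b)))))
    (and (all fun a => imp (mem a A) (ex fun b => mem (.opair a b) f))
      (all fun a => all fun b => all fun c =>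
        imp (and (mem (.opair a b) f) (mem (.opair a c) f)) (eq b c)))

/-- "`f` takes every element of `B` as a value". -/
def isOnto (f B : PName P) : Fml P :=
  all fun b => imp (mem b B) (ex fun a => mem (.opair a b) f)

/-- "`f(a) ∈ A`", where `f` is a function. -/
def valueMem (f a A : PName P) : Fml P :=
  ex fun b => and (mem (.opair a b) f) (mem b A)

/-- "the ordinal `l` is a cardinal": no function maps an element of `l` onto `l`. -/
def isCardinal (l : PName P) : Fml P :=
  neg (ex fun d => ex fun f => and (mem d l) (and (isFun f d l) (isOnto f l)))

end Fml

variable {P : Type u} [Preorder P]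

/-- `p ⊩ a = b`, where `q ≤ p` means that `q` is stronger than `p`: for every element `(c, s)` of
one of the two names and every `q ≤ p, s`, the condition `q` forces `c` into the other name. -/
def ForcesEq : PName P → PName P → P → Prop
  | .mk _ s a, .mk _ t b, p =>
    (∀ i, ∀ q ≤ p, q ≤ s i → ∃ r ≤ q, ∃ j, r ≤ t j ∧ ForcesEq (a i) (b j) r) ∧
    (∀ j, ∀ q ≤ p, q ≤ t j → ∃ r ≤ q, ∃ i, r ≤ s i ∧ ForcesEq (a i) (b j) r)

/-- `p ⊩ a ∈ b`: the set of all `r` such that `r ≤ t` and `r ⊩ a = c` for some `(c, t)` in `b` is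
dense below `p`. -/
def ForcesMem (a : PName P) : PName P → P → Prop
  | .mk _ t b, p => ∀ q ≤ p, ∃ r ≤ q, ∃ j, r ≤ t j ∧ ForcesEq a (b j) r

/-- The forcing relation `p ⊩ φ`. -/
def Forces : P → Fml P → Prop
  | p, .eq a b => ForcesEq a b p
  | p, .mem a b => ForcesMem a b p
  | p, .neg φ => ∀ q ≤ p, ¬ Forces q φ
  | p, .and φ ψ => Forces p φ ∧ Forces p ψ
  | p, .all φ => ∀ a, Forces p (φ a)

/-- The forcing notion `P` preserves the cardinal `l`: it is forced by all conditions that `l`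
is still a cardinal. -/
def PreservesCardinal (P : Type u) [Preorder P] (l : Cardinal.{u}) : Prop :=
  ∀ p : P, Forces p (.isCardinal (.check P l.ord.toPSet))

end Names

/-! ### Cardinal functions, slaloms and the Sacks property -/

/-- The well-ordered set of all ordinals below `κ`. -/
abbrev Below (κ : Cardinal.{u}) : Type u := κ.ord.ToType

/-- `h` is an increasing (in the weak sense) cofinal function from `κ` to `κ` all of whose values
are cardinals. -/
structure IsCardFun {κ : Cardinal.{u}} (h : Below κ → Cardinal.{u}) : Prop where
  lt : ∀ α, h α < κ
  mono : Monotone h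
  cofinal : ∀ μ < κ, ∃ α, μ ≤ h α

/-- The function that maps `α` to `h(α) ^ |α|`. -/
noncomputable def powFun {κ : Cardinal.{u}} (h : Below κ → Cardinal.{u}) :
    Below κ → Cardinal.{u} :=
  fun α => h α ^ #(Set.Iio α)

/-- `φ` is an `F`-slalom: a function from `κ` to the subsets of `κ` of size less than `κ` such
that `|φ(α)| ≤ F(α)` for all `α`. -/
def IsSlalom {κ : Cardinal.{u}} (F : Below κ → Cardinal.{u}) (φ : Below κ → Set (Below κ)) : Prop :=
  ∀ α, #(φ α) < κ ∧ #(φ α) ≤ F α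

/-- A set of ordinals below `κ` as a set of the ground model. -/
noncomputable def ordSet {κ : Cardinal.{u}} (A : Set (Below κ)) : PSet.{u} :=
  ⟨A, fun a => Ordinal.toPSet (a : Below κ).toOrd⟩

/-- The generalised `F`-Sacks property of the forcing notion `P`. -/
def HasSacksProperty (P : Type u) [Preorder P] {κ : Cardinal.{u}}
    (F : Below κ → Cardinal.{u}) : Prop :=
  ∀ (f : PName P) (p : P),
    Forces p (.isFun f (.check P κ.ord.toPSet) (.check P κ.ord.toPSet)) →
    ∃ φ : Below κ → Set (Below κ), IsSlalom F φ ∧ ∃ q ≤ p, ∀ α : Below κ,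
      Forces q (.valueMem f (.check P (Ordinal.toPSet α.toOrd)) (.check P (ordSet (φ α))))

/-! ### Trees and the forcing -/

/-- Sequences of length less than `κ` of ordinals below `κ`. -/
structure Node (κ : Cardinal.{u}) : Type u where
  len : Below κ
  val : Set.Iio len → Below κ

variable {κ : Cardinal.{u}}

/-- `v` extends `u`. -/
def Node.IsPrefix (u v : Node κ) : Prop :=
  ∃ hle : u.len ≤ v.len, ∀ ξ : Set.Iio u.len, v.val ⟨ξ.1, lt_of_lt_of_le ξ.2 hle⟩ = u.val ξ

/-- The restriction of `u` to `β`, for `β` less than the length of `u`. -/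
def Node.restrict (u : Node κ) (β : Set.Iio u.len) : Node κ :=
  ⟨β.1, fun ξ => u.val ⟨ξ.1, Set.mem_Iio.2 (lt_trans (Set.mem_Iio.1 ξ.2) (Set.mem_Iio.1 β.2))⟩⟩

/-- `w` is the union of the sequences `u i`. -/
def Node.IsUnion {ι : Type u} (u : ι → Node κ) (w : Node κ) : Prop :=
  (∀ i, (u i).IsPrefix w) ∧ ∀ ξ < w.len, ∃ i, ξ < (u i).len

/-- The set of immediate successors of `u` in `T`. -/
def sucSet (T : Set (Node κ)) (u : Node κ) : Set (Node κ) :=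
  {v | v ∈ T ∧ u.IsPrefix v ∧ u.len ⋖ v.len}

/-- `u` is a splitting node of `T`. -/
def IsSplitting (T : Set (Node κ)) (u : Node κ) : Prop :=
  u ∈ T ∧ 2 ≤ #(sucSet T u)

/-- `u` belongs to the `α`-th splitting level of `T`: it is splitting, and the set of all `β` below
its length at which it restricts to a splitting node has order type `α`. -/
def IsSplitLevel (T : Set (Node κ)) (α : Below κ) (u : Node κ) : Prop :=
  IsSplitting T u ∧
    Nonempty ({β : Set.Iio u.len | IsSplitting T (u.restrict β)} ≃o Set.Iio α)

/-- `T` is a condition: a (nonempty) tree such that every node extends to a splitting node, nodes of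
the `α`-th splitting level have at least `h(α)` immediate successors, and the union of a
(nonempty) increasing sequence, of length less than `κ`, of splitting nodes is splitting. -/
structure IsCondition (h : Below κ → Cardinal.{u}) (T : Set (Node κ)) : Prop where
  nonempty : T.Nonempty
  tree : ∀ u v : Node κ, u.IsPrefix v → v ∈ T → u ∈ T
  splits : ∀ u ∈ T, ∃ v, u.IsPrefix v ∧ IsSplitting T v
  card : ∀ α u, IsSplitLevel T α u → h α ≤ #(sucSet T u)
  closed : ∀ (γ : Below κ) (u : Set.Iio γ → Node κ), (Set.Iio γ).Nonempty →
    (∀ α, IsSplitting T (u α)) → (∀ α β, α ≤ β → (u α).IsPrefix (u β)) →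
    ∀ w, Node.IsUnion u w → IsSplitting T w

/-- The forcing notion `𝕊^h_κ`. -/
def SForcing (h : Below κ → Cardinal.{u}) : Type u := {T : Set (Node κ) // IsCondition h T}

theorem sucSet_mono {S T : Set (Node κ)} (hST : S ⊆ T) (u : Node κ) : sucSet S u ⊆ sucSet T u :=
  fun _ hv => ⟨hST hv.1, hv.2⟩

/-- `T ≤ S` (`T` is stronger than `S`) if `T ⊆ S` and every splitting node `u` of `T` whose sets of
immediate successors in `T` and in `S` differ has fewer of them in `T` than in `S`. -/
instance (h : Below κ → Cardinal.{u}) : Preorder (SForcing h) where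
  le T S := T.1 ⊆ S.1 ∧ ∀ u, IsSplitting T.1 u →
    sucSet T.1 u ≠ sucSet S.1 u → #(sucSet T.1 u) < #(sucSet S.1 u)
  le_refl T := ⟨fun _ hx => hx, fun _ _ hne => absurd rfl hne⟩
  le_trans T S R hTS hSR := by
    refine ⟨hTS.1.trans hSR.1, fun u hu hne => ?_⟩
    have hTS' := Cardinal.mk_le_mk_of_subset (sucSet_mono hTS.1 u)
    have hSR' := Cardinal.mk_le_mk_of_subset (sucSet_mono hSR.1 u)
    by_cases h1 : sucSet T.1 u = sucSet S.1 u
    · rw [h1] at hne ⊢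
      exact hSR.2 u ⟨hTS.1 hu.1, hu.2.trans hTS'⟩ hne
    · exact (hTS.2 u hu h1).trans_le hSR'

end TreeForcing

open TreeForcing

namespace TreeForcing

open Cardinal Set

variable {κ : Cardinal.{u}}

/-! ### The ordinals below an inaccessible cardinal -/

/-! The proof is a fusion argument. The cardinality clause of the order makes intersections of
chains work: if a node splits in all members of a chain, its successor set shrinks in cardinality
whenever it changes, so by well-foundedness it stabilises (`exists_sucSet_iInter_eq`). Hence the
forcing is closed under chains of length less than κ (`SForcing.exists_lower_bound`), and fewer than
κ values of a name can be decided outright (`Decides.exists_le`).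

For all κ values, each `x` in the product of index sets of size `max 2 (h α)` (the 2 keeps nodes
splitting where `h` is 0 or 1) guides a decreasing sequence of conditions. `T x α` is the limit of
the earlier stages, `x α` selects one of the chosen successors of its stem, and `U x α` is a
condition below that successor deciding the values up to `α + 1` (`fusion_spec`). The splitting
nodes of the tree generated by the stems are exactly the stems
(`FusionSystem.isSplitting_tree_iff`), and this tree is a condition below `p`
(`FusionSystem.isCondition_tree`, `FusionSystem.fused_le`). Every stronger condition is compatible
with some `U x α` (`FusionSystem.exists_le_U`). As `U x α` depends only on `x` up to `α`, few values
remain possible (`FusionSystem.mk_range_U_le`), which gives `exists_slalom`.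

The Sacks properties follow by comparing `fusionBound` with the two bounds. For κ⁺, a forced
surjection from some `o` below κ⁺ onto κ⁺ is composed with a ground model surjection from κ onto
`o`; a slalom then captures all its values in a set of size at most κ, a contradiction. -/

instance noMaxOrder_below [hκ : Fact κ.IsInaccessible] : NoMaxOrder (Below κ) :=
  Cardinal.noMaxOrder hκ.out.1.le

theorem mk_Iio_below_lt (α : Below κ) : #(Iio α) < κ := by
  have := Cardinal.mk_Iio_lt α (by simp)
  simpa using this

theorem mk_Iic_below_lt [hκ : Fact κ.IsInaccessible] (α : Below κ) : #(Iic α) < κ := by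
  have h : Iic α = Iio (Order.succ α) := (Order.Iio_succ α).symm
  rw [h]
  exact mk_Iio_below_lt _

theorem exists_orderIso_Iio {A : Type u} [LinearOrder A] [WellFoundedLT A] (hA : #A < κ) :
    ∃ γ : Below κ, Nonempty (A ≃o Iio γ) := by
  have h1 : Ordinal.type (α := A) (· < ·) < Ordinal.type (α := Below κ) (· < ·) := by
    rw [Ordinal.type_toType, Cardinal.lt_ord, Ordinal.card_type]
    exact hA
  obtain ⟨f⟩ := Ordinal.type_lt_iff.1 h1
  refine ⟨f.top, ⟨OrderIso.ofRelIsoLT ⟨Equiv.ofBijective (fun a => ⟨f a, f.lt_top a⟩) ⟨?_, ?_⟩, ?_⟩⟩⟩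
  · intro a b hab
    exact f.injective (Subtype.ext_iff.1 hab)
  · rintro ⟨y, hy⟩
    obtain ⟨a, ha⟩ := f.mem_range_of_rel_top hy
    exact ⟨a, Subtype.ext ha⟩
  · intro a b
    exact f.map_rel_iff

theorem exists_forall_lt_below [hκ : Fact κ.IsInaccessible] {ι : Type u} (hι : #ι < κ)
    (f : ι → Below κ) : ∃ b, ∀ i, f i < b := by
  by_contra! hcon
  have h1 : IsCofinal (range f) := fun b => by
    obtain ⟨i, hi⟩ := hcon b
    exact ⟨_, ⟨i, rfl⟩, hi⟩
  have h2 := Order.cof_le h1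
  rw [Ordinal.cof_toType, hκ.out.isRegular.cof_ord] at h2
  exact absurd (h2.trans mk_range_le) (not_le.2 hι)

theorem exists_lub_below [hκ : Fact κ.IsInaccessible] {ι : Type u} (hι : #ι < κ)
    (f : ι → Below κ) : ∃ b, (∀ i, f i ≤ b) ∧ ∀ ξ < b, ∃ i, ξ < f i := by
  obtain ⟨b, hb⟩ := exists_forall_lt_below hι f
  let S : Set (Below κ) := {b | ∀ i, f i ≤ b}
  have hS : S.Nonempty := ⟨b, fun i => (hb i).le⟩
  refine ⟨wellFounded_lt.min S hS, wellFounded_lt.min_mem S hS, fun ξ hξ => ?_⟩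
  by_contra! hcon
  exact wellFounded_lt.not_lt_min S (x := ξ) hcon hξ

/-- A strictly increasing map never moves an ordinal down, which fails at `β` if `β < α`. -/
theorem le_of_strictMono_Iio {α β : Below κ} {f : Iio α → Iio β} (hf : StrictMono f) : α ≤ β := by
  by_contra! hlt
  have key : ∀ ξ : Below κ, ∀ hξ : ξ < α, ξ ≤ (f ⟨ξ, hξ⟩ : Below κ) := by
    intro ξ
    induction ξ using WellFoundedLT.induction with
    | ind ξ ih =>
      intro hξ
      by_contra! hcon
      have h1 : (f ⟨ξ, hξ⟩ : Below κ) < α := hcon.trans hξ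
      have h2 := ih _ hcon h1
      have h3 : f ⟨(f ⟨ξ, hξ⟩ : Below κ), h1⟩ < f ⟨ξ, hξ⟩ := hf hcon
      exact absurd h2 (not_le.2 h3)
  exact absurd (key β hlt) (not_le.2 (f ⟨β, hlt⟩).2)

/-- Transfinite dependent choice. -/
theorem exists_transfinite_seq {ι X : Type*} [LinearOrder ι] [WellFoundedLT ι] [Nonempty X]
    (R : ι → ι → X → X → Prop) (Q : ι → X → Prop)
    (step : ∀ (i : ι) (g : ι → X), (∀ j < i, Q j (g j)) → (∀ j k, j < k → k < i → R j k (g j) (g k)) →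
      ∃ x, Q i x ∧ ∀ j < i, R j i (g j) x) :
    ∃ g : ι → X, (∀ i, Q i (g i)) ∧ ∀ j k, j < k → R j k (g j) (g k) := by
  classical
  let F : (i : ι) → ((j : ι) → j < i → X) → X := fun i g =>
    if hx : ∃ x, Q i x ∧ ∀ j, ∀ hj : j < i, R j i (g j hj) x then hx.choose else Classical.arbitrary X
  let g : ι → X := wellFounded_lt.fix F
  have hg : ∀ i, g i = F i (fun j _ => g j) := fun i => wellFounded_lt.fix_eq F i
  have key : ∀ i, Q i (g i) ∧ ∀ j < i, R j i (g j) (g i) := by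
    intro i
    induction i using WellFoundedLT.induction with
    | ind i ih =>
      have hx : ∃ x, Q i x ∧ ∀ j, ∀ hj : j < i, R j i (g j) x :=
        step i g (fun j hj => (ih j hj).1) (fun j k hjk hk => (ih k hk).2 j hjk)
      have : g i = hx.choose := by
        rw [hg]
        exact dif_pos hx
      rw [this]
      exact hx.choose_spec
  exact ⟨g, fun i => (key i).1, fun j k hjk => (key k).2 j hjk⟩

/-! ### Nodes -/

namespace Node

theorem isPrefix_iff {u v : Node κ} : u.IsPrefix v ↔
    u.len ≤ v.len ∧ ∀ ξ (h1 : ξ < u.len) (h2 : ξ < v.len), u.val ⟨ξ, h1⟩ = v.val ⟨ξ, h2⟩ :=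
  ⟨fun ⟨h, h'⟩ => ⟨h, fun ξ h1 _ => (h' ⟨ξ, h1⟩).symm⟩,
    fun ⟨h, h'⟩ => ⟨h, fun ξ => (h' ξ.1 ξ.2 (lt_of_lt_of_le ξ.2 h)).symm⟩⟩

theorem ext_iff_len {u v : Node κ} (h : u.len = v.len)
    (h' : ∀ ξ (h1 : ξ < u.len) (h2 : ξ < v.len), u.val ⟨ξ, h1⟩ = v.val ⟨ξ, h2⟩) : u = v := by
  obtain ⟨l, f⟩ := u
  obtain ⟨m, g⟩ := v
  obtain rfl : l = m := h
  congr 1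
  funext ξ
  exact h' ξ.1 ξ.2 ξ.2

instance : PartialOrder (Node κ) where
  le := IsPrefix
  le_refl u := isPrefix_iff.2 ⟨le_rfl, fun _ _ _ => rfl⟩
  le_trans u v w huv hvw := by
    rw [isPrefix_iff] at *
    exact ⟨huv.1.trans hvw.1, fun ξ h1 h2 =>
      (huv.2 ξ h1 (h1.trans_le huv.1)).trans (hvw.2 ξ (h1.trans_le huv.1) h2)⟩
  le_antisymm u v huv hvu := by
    rw [isPrefix_iff] at *
    exact ext_iff_len (le_antisymm huv.1 hvu.1) huv.2

theorem le_iff {u v : Node κ} : u ≤ v ↔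
    u.len ≤ v.len ∧ ∀ ξ (h1 : ξ < u.len) (h2 : ξ < v.len), u.val ⟨ξ, h1⟩ = v.val ⟨ξ, h2⟩ :=
  isPrefix_iff

theorem len_mono {u v : Node κ} (h : u ≤ v) : u.len ≤ v.len := (le_iff.1 h).1

theorem eq_of_le_of_len_le {u v : Node κ} (h : u ≤ v) (h' : v.len ≤ u.len) : u = v :=
  ext_iff_len (le_antisymm (len_mono h) h') (le_iff.1 h).2

theorem len_lt_of_lt {u v : Node κ} (h : u < v) : u.len < v.len := by
  by_contra! hle
  exact h.ne (eq_of_le_of_len_le h.le hle)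

theorem lt_of_le_of_len_lt {u v : Node κ} (h : u ≤ v) (h' : u.len < v.len) : u < v :=
  lt_of_le_of_ne h fun he => by rw [he] at h'; exact lt_irrefl _ h'

theorem le_of_len_le {u v w : Node κ} (hu : u ≤ w) (hv : v ≤ w) (h : u.len ≤ v.len) : u ≤ v := by
  rw [le_iff] at *
  exact ⟨h, fun ξ h1 h2 => (hu.2 ξ h1 (h2.trans_le hv.1)).trans (hv.2 ξ h2 (h2.trans_le hv.1)).symm⟩

theorem eq_of_len_eq {u v w : Node κ} (hu : u ≤ w) (hv : v ≤ w) (h : u.len = v.len) : u = v :=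
  eq_of_le_of_len_le (le_of_len_le hu hv h.le) h.ge

theorem lt_of_len_lt {u v w : Node κ} (hu : u ≤ w) (hv : v ≤ w) (h : u.len < v.len) : u < v :=
  lt_of_le_of_len_lt (le_of_len_le hu hv h.le) h

theorem comparable {u v w : Node κ} (hu : u ≤ w) (hv : v ≤ w) : u ≤ v ∨ v ≤ u :=
  (le_total u.len v.len).imp (le_of_len_le hu hv) (le_of_len_le hv hu)

/-- Two nodes below a common one are comparable; so one is `≤` or the other is `<`. -/
theorem le_or_lt {u v w : Node κ} (hu : u ≤ w) (hv : v ≤ w) : u ≤ v ∨ v < u :=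
  (le_or_gt u.len v.len).imp (le_of_len_le hu hv) (lt_of_len_lt hv hu)

theorem exists_le_len {v : Node κ} {β : Below κ} (hβ : β ≤ v.len) : ∃ w ≤ v, w.len = β :=
  ⟨⟨β, fun ξ => v.val ⟨ξ.1, lt_of_lt_of_le ξ.2 hβ⟩⟩, le_iff.2 ⟨hβ, fun _ _ _ => rfl⟩, rfl⟩

theorem restrict_lt (v : Node κ) (β : Iio v.len) : v.restrict β < v :=
  lt_of_le_of_len_lt (le_iff.2 ⟨le_of_lt β.2, fun _ _ _ => rfl⟩) β.2

theorem restrict_eq {w v : Node κ} (h : w < v) : v.restrict ⟨w.len, len_lt_of_lt h⟩ = w :=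
  eq_of_len_eq (restrict_lt v _).le h.le rfl

theorem exists_covBy_le [Fact κ.IsInaccessible] {u v : Node κ} (h : u < v) :
    ∃ w ≤ v, u ≤ w ∧ u.len ⋖ w.len := by
  have h1 : Order.succ u.len ≤ v.len := Order.succ_le_of_lt (len_lt_of_lt h)
  obtain ⟨w, hw, hl⟩ := exists_le_len h1
  refine ⟨w, hw, le_of_len_le h.le hw (hl ▸ Order.le_succ _), hl ▸ Order.covBy_succ _⟩

theorem lt_of_covBy {u w : Node κ} (h : u ≤ w) (h' : u.len ⋖ w.len) : u < w :=
  lt_of_le_of_len_lt h h'.lt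

theorem le_of_covBy {u w v z : Node κ} (h' : u.len ⋖ w.len) (hw : w ≤ z) (hv : v ≤ z)
    (huv : u < v) : w ≤ v :=
  le_of_len_le hw hv (h'.ge_of_gt (len_lt_of_lt huv))

theorem IsUnion.le {ι : Type u} {u : ι → Node κ} {w : Node κ} (h : IsUnion u w) (i : ι) : u i ≤ w :=
  h.1 i

theorem IsUnion.le_of_forall_le {ι : Type u} {u : ι → Node κ} {w v : Node κ} (h : IsUnion u w)
    (hv : ∀ i, u i ≤ v) : w ≤ v := by
  rw [le_iff]
  constructor
  · by_contra! hlt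
    obtain ⟨i, hi⟩ := h.2 _ hlt
    exact absurd (len_mono (hv i)) (not_le.2 hi)
  · intro ξ h1 h2
    obtain ⟨i, hi⟩ := h.2 _ h1
    exact ((le_iff.1 (h.1 i)).2 ξ hi h1).symm.trans ((le_iff.1 (hv i)).2 ξ hi h2)

theorem exists_isUnion [Fact κ.IsInaccessible] {ι : Type u} (hι : #ι < κ) (u : ι → Node κ)
    (hu : ∀ i j, u i ≤ u j ∨ u j ≤ u i) : ∃ w, IsUnion u w := by
  obtain ⟨b, hb, hb'⟩ := exists_lub_below hι fun i => (u i).len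
  choose c hc using hb'
  refine ⟨⟨b, fun ξ => (u (c ξ.1 ξ.2)).val ⟨ξ.1, hc ξ.1 ξ.2⟩⟩, fun i => ?_,
    fun ξ hξ => ⟨_, hc ξ hξ⟩⟩
  rw [isPrefix_iff]
  refine ⟨hb i, fun ξ h1 h2 => ?_⟩
  rcases hu i (c ξ h2) with h | h
  · exact (le_iff.1 h).2 ξ h1 _
  · exact ((le_iff.1 h).2 ξ _ h1).symm

/-- The union of a family with the same upper bounds. -/
theorem IsUnion.of_cofinal {ι ι' : Type u} {u : ι → Node κ} {v : ι' → Node κ} {w : Node κ}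
    (h : IsUnion u w) (h1 : ∀ i, ∃ j, u i ≤ v j) (h2 : ∀ j, ∃ i, v j ≤ u i) : IsUnion v w := by
  refine ⟨fun j => ?_, fun ξ hξ => ?_⟩
  · obtain ⟨i, hi⟩ := h2 j
    exact le_trans hi (h.le i)
  · obtain ⟨i, hi⟩ := h.2 ξ hξ
    obtain ⟨j, hj⟩ := h1 i
    exact ⟨j, hi.trans_le (len_mono hj)⟩

/-- Incomparable nodes branch off at some node. -/
theorem exists_branching [Fact κ.IsInaccessible] {u v : Node κ} (h1 : ¬ u ≤ v) (h2 : ¬ v ≤ u) :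
    ∃ w a b : Node κ, w < u ∧ w < v ∧ a ≤ u ∧ b ≤ v ∧ w ≤ a ∧ w ≤ b ∧ w.len ⋖ a.len ∧
      w.len ⋖ b.len ∧ a ≠ b := by
  let S : Set (Below κ) := {ξ | ∃ (h1 : ξ < u.len) (h2 : ξ < v.len), u.val ⟨ξ, h1⟩ ≠ v.val ⟨ξ, h2⟩}
  have hS : S.Nonempty := by
    by_contra hS
    have hS' : ∀ ξ (h1 : ξ < u.len) (h2 : ξ < v.len), u.val ⟨ξ, h1⟩ = v.val ⟨ξ, h2⟩ := by
      intro ξ a b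
      by_contra hne
      exact hS ⟨ξ, a, b, hne⟩
    rcases le_total u.len v.len with h | h
    · exact h1 (le_iff.2 ⟨h, hS'⟩)
    · exact h2 (le_iff.2 ⟨h, fun ξ a b => (hS' ξ b a).symm⟩)
  set ξ := wellFounded_lt.min S hS with hξ
  obtain ⟨hu, hv, hne⟩ : ξ ∈ S := wellFounded_lt.min_mem S hS
  have hmin : ∀ η < ξ, ∀ (h1 : η < u.len) (h2 : η < v.len), u.val ⟨η, h1⟩ = v.val ⟨η, h2⟩ := by
    intro η hη a b
    by_contra hne
    exact wellFounded_lt.not_lt_min S (x := η) ⟨a, b, hne⟩ hη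
  have hwu : u.restrict ⟨ξ, hu⟩ < u := restrict_lt _ _
  have hwv : u.restrict ⟨ξ, hu⟩ < v := lt_of_le_of_len_lt
    (le_iff.2 ⟨le_of_lt hv, fun η a b => hmin η a (lt_trans a hu) b⟩) hv
  obtain ⟨a, ha, hwa, hca⟩ := exists_covBy_le hwu
  obtain ⟨b, hb, hwb, hcb⟩ := exists_covBy_le hwv
  refine ⟨_, a, b, hwu, hwv, ha, hb, hwa, hwb, hca, hcb, ?_⟩
  rintro rfl
  have e1 := (le_iff.1 ha).2 ξ hca.lt hu
  have e2 := (le_iff.1 hb).2 ξ hca.lt hv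
  exact hne (e1.symm.trans e2)

end Node

/-! ### Splitting nodes and their levels -/

variable {h : Below κ → Cardinal.{u}} {S T : Set (Node κ)}

theorem IsSplitting.exists_ne {u : Node κ} (hu : IsSplitting T u) :
    ∃ a ∈ sucSet T u, ∃ b ∈ sucSet T u, a ≠ b := by
  have := hu.2
  rw [two_le_iff] at this
  obtain ⟨a, b, hab⟩ := this
  exact ⟨a.1, a.2, b.1, b.2, fun he => hab (Subtype.ext he)⟩

theorem isSplitting_of_ne {u a b : Node κ} (hu : u ∈ T) (ha : a ∈ sucSet T u) (hb : b ∈ sucSet T u)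
    (hab : a ≠ b) : IsSplitting T u :=
  ⟨hu, two_le_iff.2 ⟨⟨a, ha⟩, ⟨b, hb⟩, fun he => hab (Subtype.ext_iff.1 he)⟩⟩

theorem IsSplitting.mono {u : Node κ} (hST : S ⊆ T) (hu : IsSplitting S u) : IsSplitting T u :=
  ⟨hST hu.1, hu.2.trans (mk_le_mk_of_subset (sucSet_mono hST u))⟩

/-- Below `u` there is a copy of `A` consisting of splitting nodes of `T`. -/
def HasSplittingsBelow (T : Set (Node κ)) (A : Set (Below κ)) (u : Node κ) : Prop :=
  ∃ g : A → Node κ, StrictMono g ∧ ∀ a, IsSplitting T (g a) ∧ g a < u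

theorem HasSplittingsBelow.mono {A : Set (Below κ)} {u : Node κ} (hST : S ⊆ T)
    (hu : HasSplittingsBelow S A u) : HasSplittingsBelow T A u := by
  obtain ⟨g, hg, hg'⟩ := hu
  exact ⟨g, hg, fun a => ⟨(hg' a).1.mono hST, (hg' a).2⟩⟩

theorem IsSplitLevel.hasSplittingsBelow {α : Below κ} {u : Node κ} (hu : IsSplitLevel T α u) :
    HasSplittingsBelow T (Iio α) u := by
  obtain ⟨-, ⟨e⟩⟩ := hu
  refine ⟨fun a => u.restrict (e.symm a).1, fun a b hab => ?_, fun a => ⟨(e.symm a).2, ?_⟩⟩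
  · have h1 : e.symm a < e.symm b := e.symm.strictMono hab
    exact Node.lt_of_len_lt (Node.restrict_lt _ _).le (Node.restrict_lt _ _).le h1
  · exact Node.restrict_lt _ _

/-- The splitting restrictions of `u` are well ordered by length, of some type `β` below κ, and the
given copy of `α` embeds into them. -/
theorem HasSplittingsBelow.exists_isSplitLevel {α : Below κ} {u : Node κ} (hu : IsSplitting T u)
    (hα : HasSplittingsBelow T (Iio α) u) : ∃ β, α ≤ β ∧ IsSplitLevel T β u := by
  have hcard : #{β : Set.Iio u.len | IsSplitting T (u.restrict β)} < κ :=
    (mk_subtype_le _).trans_lt (mk_Iio_below_lt u.len)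
  obtain ⟨β, ⟨e⟩⟩ := exists_orderIso_Iio hcard
  refine ⟨β, ?_, hu, ⟨e⟩⟩
  obtain ⟨g, hg, hg'⟩ := hα
  refine le_of_strictMono_Iio (f := fun a => e ⟨⟨(g a).len, Node.len_lt_of_lt (hg' a).2⟩, ?_⟩) ?_
  · rw [mem_ofPred_eq, Node.restrict_eq (hg' a).2]
    exact (hg' a).1
  · intro a b hab
    apply e.strictMono
    exact Node.len_lt_of_lt (hg hab)

namespace IsCondition

theorem card_le (hT : IsCondition h T) (hh : Monotone h) {α : Below κ} {u : Node κ}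
    (hu : IsSplitting T u) (hα : HasSplittingsBelow T (Iio α) u) : h α ≤ #(sucSet T u) := by
  obtain ⟨β, hαβ, hβ⟩ := hα.exists_isSplitLevel hu
  exact (hh hαβ).trans (hT.card β u hβ)

theorem mem_of_le (hT : IsCondition h T) {u v : Node κ} (huv : u ≤ v) (hv : v ∈ T) : u ∈ T :=
  hT.tree u v huv hv

theorem exists_splitting (hT : IsCondition h T) {u : Node κ} (hu : u ∈ T) :
    ∃ v, u ≤ v ∧ IsSplitting T v := hT.splits u hu

/-- The closure of the set of splitting nodes under unions of chains. -/
theorem isSplitting_of_isUnion (hT : IsCondition h T) {ι : Type u} [Nonempty ι] (hι : #ι < κ)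
    {u : ι → Node κ} (hu : ∀ i, IsSplitting T (u i)) {w : Node κ} (hw : Node.IsUnion u w) :
    IsSplitting T w := by
  have hchain : ∀ i j, (u i).len ≤ (u j).len → u i ≤ u j := fun i j =>
    Node.le_of_len_le (hw.le i) (hw.le j)
  -- The family carries no order of its own, so the chain is re-enumerated by the lengths of its
  -- nodes.
  let L : Set (Below κ) := range fun i => (u i).len
  have hL : #L < κ := mk_range_le.trans_lt hι
  obtain ⟨γ, ⟨e⟩⟩ := exists_orderIso_Iio hL
  choose c hc using fun l : L => l.2
  refine hT.closed γ (fun a => u (c (e.symm a))) ?_ (fun a => hu _) (fun a b hab => ?_) w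
    ⟨fun a => hw.1 _, fun ξ hξ => ?_⟩
  · obtain ⟨i⟩ := ‹Nonempty ι›
    exact ⟨_, (e ⟨_, ⟨i, rfl⟩⟩).2⟩
  · apply hchain
    have h1 : e.symm a ≤ e.symm b := e.symm.monotone hab
    have h2 := hc (e.symm a)
    have h3 := hc (e.symm b)
    simp only at h2 h3
    rw [h2, h3]
    exact h1
  · obtain ⟨i, hi⟩ := hw.2 ξ hξ
    refine ⟨e ⟨_, ⟨i, rfl⟩⟩, ?_⟩
    have h2 := hc (e.symm (e ⟨_, ⟨i, rfl⟩⟩))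
    simp only at h2
    rw [h2, e.symm_apply_apply]
    exact hi

/-- Having a copy of `α` below a node persists to larger trees, whereas the exact splitting level
may change. This form of the cardinality clause is therefore the one that passes to cones,
intersections and fusions. -/
theorem of_hasSplittingsBelow (nonempty : T.Nonempty) (tree : ∀ u v : Node κ, u ≤ v → v ∈ T → u ∈ T)
    (splits : ∀ u ∈ T, ∃ v, u ≤ v ∧ IsSplitting T v)
    (card : ∀ α u, IsSplitting T u → HasSplittingsBelow T (Iio α) u → h α ≤ #(sucSet T u))
    (closed : ∀ (ι : Type u) (u : ι → Node κ), Nonempty ι → #ι < κ → (∀ i, IsSplitting T (u i)) →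
      ∀ w, Node.IsUnion u w → IsSplitting T w) : IsCondition h T where
  nonempty := nonempty
  tree := tree
  splits := splits
  card α u hu := card α u hu.1 hu.hasSplittingsBelow
  closed γ u hγ hu _ w hw := closed _ u hγ.to_subtype (mk_Iio_below_lt γ) hu w hw

end IsCondition

/-! ### Stems and cones -/

theorem exists_root [hκ : Fact κ.IsInaccessible] : ∃ r : Node κ, ∀ u, r ≤ u := by
  have hne : Nonempty (Below κ) := by
    rw [Ordinal.nonempty_toType_iff, Ne, Cardinal.ord_eq_zero]
    exact hκ.out.ne_zero
  obtain ⟨b, hb⟩ : ∃ b : Below κ, ∀ a, b ≤ a :=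
    ⟨wellFounded_lt.min univ univ_nonempty, fun a => not_lt.1 (wellFounded_lt.not_lt_min _ (mem_univ a))⟩
  exact ⟨⟨b, fun ξ => absurd ξ.2 (not_lt.2 (hb ξ.1))⟩, fun u =>
    Node.le_iff.2 ⟨hb _, fun ξ h1 _ => absurd h1 (not_lt.2 (hb ξ))⟩⟩

theorem eq_of_mem_sucSet_of_le {u a b z : Node κ} (ha : a ∈ sucSet T u) (hb : b ∈ sucSet S u)
    (haz : a ≤ z) (hbz : b ≤ z) : a = b :=
  le_antisymm (Node.le_of_covBy ha.2.2 haz hbz (Node.lt_of_covBy hb.2.1 hb.2.2))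
    (Node.le_of_covBy hb.2.2 hbz haz (Node.lt_of_covBy ha.2.1 ha.2.2))

theorem lt_of_mem_sucSet {u a : Node κ} (ha : a ∈ sucSet T u) : u < a :=
  Node.lt_of_covBy ha.2.1 ha.2.2

/-- A successor of `u` comparable with `z > u` is below `z`. -/
theorem le_of_mem_sucSet {u a z : Node κ} (ha : a ∈ sucSet T u) (huz : u < z)
    (haz : a ≤ z ∨ z ≤ a) : a ≤ z :=
  haz.elim id fun hza => Node.le_of_covBy ha.2.2 le_rfl hza huz

namespace IsCondition

/-- Take a splitting node of least length above `u`. A node above `u` incomparable with it would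
branch off at a splitting node: above `u` this contradicts minimality, and below `u` both branches
would follow the path to `u`. -/
theorem exists_next_splitting [Fact κ.IsInaccessible] (hT : IsCondition h T) {u : Node κ}
    (hu : u ∈ T) :
    ∃ v, u ≤ v ∧ IsSplitting T v ∧ ∀ x ∈ T, u ≤ x → x ≤ v ∨ v ≤ x := by
  let L : Set (Below κ) := {l | ∃ v, u ≤ v ∧ IsSplitting T v ∧ v.len = l}
  have hL : L.Nonempty := by
    obtain ⟨v, h1, h2⟩ := hT.exists_splitting hu
    exact ⟨_, v, h1, h2, rfl⟩
  obtain ⟨v, huv, hv, hl⟩ := wellFounded_lt.min_mem L hL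
  refine ⟨v, huv, hv, fun x hx hux => ?_⟩
  by_contra! hcon
  obtain ⟨w, a, b, hwx, hwv, hax, hbv, hwa, hwb, hca, hcb, hab⟩ :=
    Node.exists_branching hcon.1 hcon.2
  have hw : IsSplitting T w := isSplitting_of_ne (hT.mem_of_le hwx.le hx)
    (a := a) (b := b) ⟨hT.mem_of_le hax hx, hwa, hca⟩ ⟨hT.mem_of_le hbv hv.1, hwb, hcb⟩ hab
  rcases Node.le_or_lt huv hwv.le with huw | hwu
  · refine wellFounded_lt.not_lt_min L (x := w.len) ⟨w, huw, hw, rfl⟩ ?_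
    rw [← hl]
    exact Node.len_lt_of_lt hwv
  · exact hab (eq_of_mem_sucSet_of_le (T := univ) (S := univ) ⟨trivial, hwa, hca⟩ ⟨trivial, hwb, hcb⟩
      (Node.le_of_covBy hca hax hux hwu) (Node.le_of_covBy hcb hbv huv hwu))

theorem exists_splitting_gt (hT : IsCondition h T) {u : Node κ} (hu : u ∈ T) :
    ∃ v, u < v ∧ IsSplitting T v := by
  obtain ⟨v, huv, hv⟩ := hT.exists_splitting hu
  obtain ⟨a, ha, -⟩ := hv.exists_ne
  obtain ⟨w, haw, hw⟩ := hT.exists_splitting ha.1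
  exact ⟨w, huv.trans_lt ((lt_of_mem_sucSet ha).trans_le haw), hw⟩

/-- Closure of the splitting nodes under unions carries the recursion past limits. -/
theorem exists_strictMono_splitting [Fact κ.IsInaccessible] (hT : IsCondition h T) {w : Node κ}
    (hw : w ∈ T) : ∃ g : Below κ → Node κ, StrictMono g ∧ ∀ a, IsSplitting T (g a) ∧ w ≤ g a := by
  have : Nonempty (Node κ) := ⟨w⟩
  obtain ⟨g, hg, hg'⟩ := exists_transfinite_seq (ι := Below κ) (X := Node κ) (fun _ _ x y => x < y)
    (fun _ x => IsSplitting T x ∧ w ≤ x) (by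
    intro i g hg hg'
    rcases isEmpty_or_nonempty (Iio i) with hi | hi
    · obtain ⟨v, hwv, hv⟩ := hT.exists_splitting hw
      exact ⟨v, ⟨hv, hwv⟩, fun j hj => (hi.false ⟨j, hj⟩).elim⟩
    · obtain ⟨z, hz⟩ := Node.exists_isUnion (mk_Iio_below_lt i) (fun j => g j.1) (fun j k => by
        rcases lt_trichotomy j.1 k.1 with hjk | hjk | hjk
        · exact Or.inl (hg' _ _ hjk k.2).le
        · exact Or.inl (by rw [hjk])
        · exact Or.inr (hg' _ _ hjk j.2).le)
      have hz' := hT.isSplitting_of_isUnion (mk_Iio_below_lt i) (fun j => (hg j.1 j.2).1) hz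
      obtain ⟨v, hzv, hv⟩ := hT.exists_splitting_gt hz'.1
      refine ⟨v, ⟨hv, ?_⟩, fun j hj => (hz.le ⟨j, hj⟩).trans_lt hzv⟩
      obtain ⟨j⟩ := hi
      exact ((hg j.1 j.2).2.trans (hz.le j)).trans hzv.le)
  exact ⟨g, hg', hg⟩

end IsCondition

/-- The node `s` is the stem of `T`: the first splitting node. -/
def IsStem (T : Set (Node κ)) (s : Node κ) : Prop :=
  IsSplitting T s ∧ ∀ u ∈ T, u ≤ s ∨ s ≤ u

theorem IsCondition.exists_isStem [Fact κ.IsInaccessible] (hT : IsCondition h T) :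
    ∃ s, IsStem T s := by
  obtain ⟨r, hr⟩ := exists_root (κ := κ)
  obtain ⟨x, hx⟩ := hT.nonempty
  obtain ⟨s, -, hs, hs'⟩ := hT.exists_next_splitting (hT.mem_of_le (hr x) hx)
  exact ⟨s, hs, fun u hu => hs' u hu (hr u)⟩

/-- A node strictly below the stem has only one successor, since all its successors lie on the path
to the stem. -/
theorem IsStem.le {s v : Node κ} (hs : IsStem T s) (hv : IsSplitting T v) : s ≤ v := by
  rcases hs.2 v hv.1 with hvs | hvs
  · rcases hvs.eq_or_lt with rfl | hlt
    · exact le_rfl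
    · obtain ⟨a, ha, b, hb, hab⟩ := hv.exists_ne
      exact (hab (eq_of_mem_sucSet_of_le ha hb (le_of_mem_sucSet ha hlt (hs.2 a ha.1))
        (le_of_mem_sucSet hb hlt (hs.2 b hb.1)))).elim
  · exact hvs

/-- The set of all nodes of `T` that are comparable with `w`. -/
def cone (T : Set (Node κ)) (w : Node κ) : Set (Node κ) := {u ∈ T | u ≤ w ∨ w ≤ u}

theorem cone_subset (T : Set (Node κ)) (w : Node κ) : cone T w ⊆ T := fun _ hu => hu.1

theorem sucSet_cone {u w : Node κ} (hwu : w ≤ u) : sucSet (cone T w) u = sucSet T u := by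
  ext a
  exact ⟨fun ha => ⟨ha.1.1, ha.2⟩, fun ha => ⟨⟨ha.1, Or.inr (hwu.trans ha.2.1)⟩, ha.2⟩⟩

theorem isSplitting_cone_iff {u w : Node κ} :
    IsSplitting (cone T w) u ↔ IsSplitting T u ∧ w ≤ u := by
  constructor
  · intro hu
    refine ⟨hu.mono (cone_subset T w), ?_⟩
    rcases hu.1.2 with huw | hwu
    · rcases huw.eq_or_lt with rfl | hlt
      · exact le_rfl
      · obtain ⟨a, ha, b, hb, hab⟩ := hu.exists_ne
        exact (hab (eq_of_mem_sucSet_of_le ha hb (le_of_mem_sucSet ha hlt ha.1.2)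
          (le_of_mem_sucSet hb hlt hb.1.2))).elim
    · exact hwu
  · rintro ⟨hu, hwu⟩
    exact ⟨⟨hu.1, Or.inr hwu⟩, by rw [sucSet_cone hwu]; exact hu.2⟩

theorem IsCondition.cone (hT : IsCondition h T) (hh : Monotone h) {w : Node κ} (hw : w ∈ T) :
    IsCondition h (cone T w) := by
  refine IsCondition.of_hasSplittingsBelow ⟨w, hw, Or.inl le_rfl⟩ ?_ ?_ ?_ ?_
  · rintro u v huv ⟨hv, hvw⟩
    refine ⟨hT.mem_of_le huv hv, ?_⟩
    rcases hvw with hvw | hwv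
    · exact Or.inl (huv.trans hvw)
    · exact Node.comparable huv hwv
  · rintro u ⟨hu, huw | hwu⟩
    · obtain ⟨v, hwv, hv⟩ := hT.exists_splitting hw
      exact ⟨v, huw.trans hwv, isSplitting_cone_iff.2 ⟨hv, hwv⟩⟩
    · obtain ⟨v, huv, hv⟩ := hT.exists_splitting hu
      exact ⟨v, huv, isSplitting_cone_iff.2 ⟨hv, hwu.trans huv⟩⟩
  · intro α u hu hα
    have hu' := isSplitting_cone_iff.1 hu
    rw [sucSet_cone hu'.2]
    exact hT.card_le hh hu'.1 (hα.mono (cone_subset T w))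
  · intro ι u hne hι hu z hz
    have hu' := fun i => isSplitting_cone_iff.1 (hu i)
    obtain ⟨i⟩ := hne
    have : Nonempty ι := ⟨i⟩
    exact isSplitting_cone_iff.2
      ⟨hT.isSplitting_of_isUnion hι (fun i => (hu' i).1) hz, (hu' i).2.trans (hz.le i)⟩

/-- The cone of a condition at one of its nodes. -/
def SForcing.cone (T : SForcing h) (hh : Monotone h) (w : Node κ) (hw : w ∈ T.1) : SForcing h :=
  ⟨TreeForcing.cone T.1 w, T.2.cone hh hw⟩

theorem SForcing.le_iff {S T : SForcing h} : S ≤ T ↔ S.1 ⊆ T.1 ∧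
    ∀ u, IsSplitting S.1 u → sucSet S.1 u ≠ sucSet T.1 u → #(sucSet S.1 u) < #(sucSet T.1 u) :=
  Iff.rfl

theorem SForcing.cone_le (T : SForcing h) (hh : Monotone h) (w : Node κ) (hw : w ∈ T.1) :
    T.cone hh w hw ≤ T :=
  ⟨cone_subset _ _, fun _ hu hne => absurd (sucSet_cone (isSplitting_cone_iff.1 hu).2) hne⟩

/-! ### Intersections of chains -/

/-- Choose `i` with the fewest successors of `u`. A stronger member of the chain with a different
successor set would have strictly fewer. -/
theorem exists_sucSet_iInter_eq {ι : Type u} [Nonempty ι] (S : ι → SForcing h)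
    (hS : ∀ i j, S i ≤ S j ∨ S j ≤ S i) {u : Node κ} (hu : ∀ i, IsSplitting (S i).1 u) :
    ∃ i, sucSet (⋂ i, (S i).1) u = sucSet (S i).1 u := by
  obtain ⟨i, hi⟩ : ∃ i, ∀ j, #(sucSet (S i).1 u) ≤ #(sucSet (S j).1 u) := by
    let C : Set Cardinal.{u} := range fun i => #(sucSet (S i).1 u)
    have hC : C.Nonempty := range_nonempty _
    obtain ⟨i, hi⟩ := Cardinal.lt_wf.min_mem C hC
    refine ⟨i, fun j => ?_⟩
    simp only at hi
    rw [hi]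
    exact not_lt.1 (Cardinal.lt_wf.not_lt_min C ⟨j, rfl⟩)
  refine ⟨i, Subset.antisymm (sucSet_mono (iInter_subset _ i) u) fun a ha => ⟨?_, ha.2⟩⟩
  rw [mem_iInter]
  intro j
  rcases hS i j with hij | hji
  · exact hij.1 ha.1
  · by_cases he : sucSet (S j).1 u = sucSet (S i).1 u
    · exact (he ▸ ha : a ∈ sucSet (S j).1 u).1
    · exact absurd (hji.2 u (hu j) he) (not_lt.2 (hi j))

theorem isSplitting_iInter_iff {ι : Type u} [Nonempty ι] (S : ι → SForcing h)
    (hS : ∀ i j, S i ≤ S j ∨ S j ≤ S i) {u : Node κ} :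
    IsSplitting (⋂ i, (S i).1) u ↔ ∀ i, IsSplitting (S i).1 u := by
  refine ⟨fun hu i => hu.mono (iInter_subset _ i), fun hu => ⟨mem_iInter.2 fun i => (hu i).1, ?_⟩⟩
  obtain ⟨i, hi⟩ := exists_sucSet_iInter_eq S hS hu
  rw [hi]
  exact (hu i).2

/-- The delicate clause is the existence of splitting nodes above a given `u`. The first splitting
node above `u` moves upwards as the conditions get stronger, and the union of these nodes splits in
every member of the chain. -/
theorem isCondition_iInter [Fact κ.IsInaccessible] (hh : Monotone h) {ι : Type u} [Nonempty ι]
    (hι : #ι < κ) (S : ι → SForcing h) (hS : ∀ i j, S i ≤ S j ∨ S j ≤ S i) :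
    IsCondition h (⋂ i, (S i).1) := by
  obtain ⟨i₀⟩ := ‹Nonempty ι›
  have : Nonempty ι := ⟨i₀⟩
  refine IsCondition.of_hasSplittingsBelow ?_ ?_ ?_ ?_ ?_
  · obtain ⟨r, hr⟩ := exists_root (κ := κ)
    refine ⟨r, mem_iInter.2 fun i => ?_⟩
    obtain ⟨x, hx⟩ := (S i).2.nonempty
    exact (S i).2.mem_of_le (hr x) hx
  · intro u v huv hv
    rw [mem_iInter] at *
    exact fun i => (S i).2.mem_of_le huv (hv i)
  · intro u hu
    rw [mem_iInter] at hu
    choose v huv hv hv' using fun i => (S i).2.exists_next_splitting (hu i)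
    have hmono : ∀ i j, S i ≤ S j → v j ≤ v i ∧ IsSplitting (S j).1 (v i) := by
      intro i j hij
      have h1 : IsSplitting (S j).1 (v i) := (hv i).mono hij.1
      refine ⟨?_, h1⟩
      rcases hv' j (v i) h1.1 (huv i) with hle | hle
      · rcases hle.eq_or_lt with he | hlt
        · exact he.ge
        · obtain ⟨a, ha, b, hb, hab⟩ := h1.exists_ne
          refine (hab (eq_of_mem_sucSet_of_le (z := v j) ha hb ?_ ?_)).elim
          · exact le_of_mem_sucSet ha hlt (hv' j a ha.1 ((huv i).trans ha.2.1))
          · exact le_of_mem_sucSet hb hlt (hv' j b hb.1 ((huv i).trans hb.2.1))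
      · exact hle
    obtain ⟨z, hz⟩ := Node.exists_isUnion hι v (fun i j =>
      (hS i j).elim (fun hij => Or.inr (hmono i j hij).1) (fun hji => Or.inl (hmono j i hji).1))
    refine ⟨z, (huv i₀).trans (hz.le i₀), (isSplitting_iInter_iff S hS).2 fun j => ?_⟩
    -- Only the nodes coming from conditions below `S j` are known to split in `S j`; they are
    -- cofinal among all of them.
    let J : Type u := {i // S i ≤ S j}
    have : Nonempty J := ⟨⟨j, le_rfl⟩⟩
    refine (S j).2.isSplitting_of_isUnion (ι := J) ((mk_subtype_le _).trans_lt hι)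
      (u := fun i => v i.1) (fun i => (hmono i.1 j i.2).2) (hz.of_cofinal ?_ fun i => ⟨i.1, le_rfl⟩)
    intro i
    rcases hS i j with hij | hji
    · exact ⟨⟨i, hij⟩, le_rfl⟩
    · exact ⟨⟨j, le_rfl⟩, (hmono j i hji).1⟩
  · intro α u hu hα
    obtain ⟨i, hi⟩ := exists_sucSet_iInter_eq S hS ((isSplitting_iInter_iff S hS).1 hu)
    rw [hi]
    exact (S i).2.card_le hh (hu.mono (iInter_subset _ i)) (hα.mono (iInter_subset _ i))
  · intro ι' u hne hι' hu w hw
    rw [isSplitting_iInter_iff S hS]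
    exact fun i => (S i).2.isSplitting_of_isUnion hι' (fun j => (hu j).mono (iInter_subset _ i)) hw

/-- The intersection of a chain of fewer than `κ` conditions. -/
def SForcing.iInter [Fact κ.IsInaccessible] (hh : Monotone h) {ι : Type u} [Nonempty ι]
    (hι : #ι < κ) (S : ι → SForcing h) (hS : ∀ i j, S i ≤ S j ∨ S j ≤ S i) : SForcing h :=
  ⟨_, isCondition_iInter hh hι S hS⟩

theorem SForcing.iInter_le [Fact κ.IsInaccessible] (hh : Monotone h) {ι : Type u} [Nonempty ι]
    (hι : #ι < κ) (S : ι → SForcing h) (hS : ∀ i j, S i ≤ S j ∨ S j ≤ S i) (j : ι) :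
    SForcing.iInter hh hι S hS ≤ S j := by
  refine ⟨iInter_subset _ j, fun u hu hne => ?_⟩
  have hu' : ∀ i, IsSplitting (S i).1 u := (isSplitting_iInter_iff S hS).1 hu
  obtain ⟨i, hi⟩ := exists_sucSet_iInter_eq S hS hu'
  change sucSet (⋂ i, (S i).1) u ≠ _ at hne
  change #(sucSet (⋂ i, (S i).1) u) < _
  rw [hi] at hne ⊢
  rcases hS i j with hij | hji
  · exact hij.2 u (hu' i) hne
  · refine absurd ?_ hne
    refine Subset.antisymm ?_ (sucSet_mono hji.1 u)
    rw [← hi]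
    exact sucSet_mono (iInter_subset _ j) u

/-- The forcing notion is `<κ`-closed. -/
theorem SForcing.exists_lower_bound [Fact κ.IsInaccessible] (hh : Monotone h) {ι : Type u}
    (hι : #ι < κ) (p : SForcing h) (S : ι → SForcing h) (hp : ∀ i, S i ≤ p)
    (hS : ∀ i j, S i ≤ S j ∨ S j ≤ S i) : ∃ q ≤ p, ∀ i, q ≤ S i := by
  rcases isEmpty_or_nonempty ι with hi | ⟨⟨i⟩⟩
  · exact ⟨p, le_rfl, fun i => (hi.false i).elim⟩
  · have : Nonempty ι := ⟨i⟩
    exact ⟨_, (iInter_le hh hι S hS i).trans (hp i), SForcing.iInter_le hh hι S hS⟩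

/-! ### Deciding many values -/

/-- An abstract name for a function on `κ`: a family of relations `D ξ v p`, read as
"`p` decides the value at `ξ` to be `v`". -/
structure Decides (h : Below κ → Cardinal.{u}) (V : Type*) where
  rel : Below κ → V → SForcing h → Prop
  mono : ∀ {ξ v p q}, q ≤ p → rel ξ v p → rel ξ v q
  dense : ∀ ξ p, ∃ q ≤ p, ∃ v, rel ξ v q

theorem Decides.exists_le [Fact κ.IsInaccessible] (hh : Monotone h) {V : Type*} (D : Decides h V)
    (p : SForcing h) (η : Below κ) : ∃ q ≤ p, ∀ ξ ≤ η, ∃ v, D.rel ξ v q := by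
  have : Nonempty (SForcing h) := ⟨p⟩
  obtain ⟨g, hg, hg'⟩ := exists_transfinite_seq (ι := Below κ) (X := SForcing h)
    (fun _ _ x y => y ≤ x) (fun i x => x ≤ p ∧ ∃ v, D.rel i v x) (by
      intro i g hg hg'
      obtain ⟨q, hqp, hq⟩ := SForcing.exists_lower_bound hh (mk_Iio_below_lt i) p (fun j => g j.1)
        (fun j => (hg j.1 j.2).1) (fun j k => by
          rcases lt_trichotomy j.1 k.1 with hjk | hjk | hjk
          · exact Or.inr (hg' _ _ hjk k.2)
          · exact Or.inl (by rw [hjk])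
          · exact Or.inl (hg' _ _ hjk j.2))
      obtain ⟨r, hrq, v, hv⟩ := D.dense i q
      exact ⟨r, ⟨hrq.trans hqp, v, hv⟩, fun j hj => hrq.trans (hq ⟨j, hj⟩)⟩)
  refine ⟨g η, (hg η).1, fun ξ hξ => ?_⟩
  obtain ⟨v, hv⟩ := (hg ξ).2
  rcases hξ.eq_or_lt with rfl | hlt
  · exact ⟨v, hv⟩
  · exact ⟨v, D.mono (hg' _ _ hlt) hv⟩

/-- Splitting nodes with `ξ` many splitting nodes below, when counting starts after `β`, have at
least `h ξ` successors. -/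
def CardAfter (h : Below κ → Cardinal.{u}) (β : Below κ) (T : Set (Node κ)) : Prop :=
  ∀ ξ u, IsSplitting T u → HasSplittingsBelow T (Ioo β ξ) u → h ξ ≤ #(sucSet T u)

/-- `Iio ξ` is covered by `Iic β` and `Ioo β ξ`. The first part is placed below `v`, and splitting
nodes of the cone lie above `v`. -/
theorem HasSplittingsBelow.glue {β ξ : Below κ} {u v : Node κ}
    (h1 : HasSplittingsBelow T (Iic β) v) (h2 : HasSplittingsBelow (cone T v) (Ioo β ξ) u)
    (hvu : v ≤ u) : HasSplittingsBelow T (Iio ξ) u := by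
  classical
  obtain ⟨g, hg, hg'⟩ := h1
  obtain ⟨k, hk, hk'⟩ := h2
  refine ⟨fun a => if ha : a.1 ≤ β then g ⟨a, ha⟩ else k ⟨a, not_le.1 ha, a.2⟩, ?_, ?_⟩
  · intro a b hab
    by_cases ha : a.1 ≤ β <;> by_cases hb : b.1 ≤ β
    · simp only [ha, hb, dite_true]
      exact hg hab
    · simp only [ha, hb, dite_true, dite_false]
      exact (hg' _).2.trans_le (isSplitting_cone_iff.1 (hk' _).1).2
    · exact absurd (le_trans (le_of_lt (show a.1 < b.1 from hab)) hb) ha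
    · simp only [ha, hb, dite_false]
      exact hk hab
  · intro a
    by_cases ha : a.1 ≤ β
    · simp only [ha, dite_true]
      exact ⟨(hg' _).1, (hg' _).2.trans_le hvu⟩
    · simp only [ha, dite_false]
      exact ⟨(isSplitting_cone_iff.1 (hk' _).1).1, (hk' _).2⟩

/-- Pass to the cone at a node with a copy of `Iic β` below it: these nodes replace the indices that
`CardAfter` does not count. -/
theorem Decides.exists_le_cardAfter [Fact κ.IsInaccessible] (hh : Monotone h) {V : Type*}
    (D : Decides h V) (p : SForcing h) (β η : Below κ) :
    ∃ q ≤ p, CardAfter h β q.1 ∧ ∀ ξ ≤ η, ∃ v, D.rel ξ v q := by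
  obtain ⟨q, hqp, hq⟩ := D.exists_le hh p η
  obtain ⟨w, hw⟩ := q.2.nonempty
  obtain ⟨g, hg, hg'⟩ := q.2.exists_strictMono_splitting hw
  set v := g (Order.succ β)
  have hv : v ∈ q.1 := (hg' _).1.1
  refine ⟨q.cone hh v hv, (q.cone_le hh v hv).trans hqp, fun ξ u hu hξ => ?_, fun ξ hξ => ?_⟩
  · have hu' := isSplitting_cone_iff.1 hu
    change h ξ ≤ #(sucSet (TreeForcing.cone q.1 v) u)
    rw [sucSet_cone hu'.2]
    refine q.2.card_le hh hu'.1 (HasSplittingsBelow.glue ?_ hξ hu'.2)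
    exact ⟨fun a => g a, fun a b hab => hg hab, fun a =>
      ⟨(hg' _).1, hg (a.2.trans_lt (Order.lt_succ β))⟩⟩
  · obtain ⟨v, hv⟩ := hq ξ hξ
    exact ⟨v, D.mono (q.cone_le hh _ _) hv⟩

/-! ### Fusion -/

/-- The index set for the successors of the nodes on level `α` of the fusion. -/
def Index (h : Below κ → Cardinal.{u}) (α : Below κ) : Type u := (max 2 (h α)).out

theorem mk_index (α : Below κ) : #(Index h α) = max 2 (h α) := mk_out _

/-- The order permits a successor set to be kept or to be made strictly smaller. If `A` has exactly
the size of the index set, a bijection keeps it; otherwise the range of any injection is smaller. -/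
theorem exists_index_embedding {α : Below κ} {A : Set (Node κ)} (hA : max 2 (h α) ≤ #A) :
    ∃ e : Index h α → Node κ, Function.Injective e ∧ range e ⊆ A ∧ (range e ≠ A → #(range e) < #A) := by
  rw [← mk_index] at hA
  rcases hA.eq_or_lt with heq | hlt
  · obtain ⟨f⟩ := Cardinal.eq.1 heq
    refine ⟨fun m => f m, Subtype.val_injective.comp f.injective, ?_, fun hne => (hne ?_).elim⟩
    · rintro _ ⟨m, rfl⟩
      exact (f m).2
    · ext a
      constructor
      · rintro ⟨m, rfl⟩
        exact (f m).2
      · intro ha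
        exact ⟨f.symm ⟨a, ha⟩, by simp⟩
  · obtain ⟨f⟩ := hA
    have hf : Function.Injective fun m => (f m : Node κ) := Subtype.val_injective.comp f.injective
    refine ⟨fun m => f m, hf, ?_, fun _ => ?_⟩
    · rintro _ ⟨m, rfl⟩
      exact (f m).2
    · rwa [mk_range_eq _ hf]

/-- A tree of conditions, indexed by the initial segments of the elements `x` of the product of all
the index sets. The condition `T x α` is the intersection of `p` and all `U x β` with `β < α`, and
`U x α` is an extension of its cone at the successor with number `x α` of its stem. -/
structure FusionSystem {V : Type u} (D : Decides h V) (p : SForcing h) where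
  T : (∀ α, Index h α) → Below κ → SForcing h
  U : (∀ α, Index h α) → Below κ → SForcing h
  stem : SForcing h → Node κ
  next : (α : Below κ) → SForcing h → Index h α → Node κ
  T_le : ∀ x α, T x α ≤ p
  T_le_U : ∀ x {α β}, β < α → T x α ≤ U x β
  U_le : ∀ x α, U x α ≤ T x α
  U_subset : ∀ x α, (U x α).1 ⊆ cone (T x α).1 (next α (T x α) (x α))
  splitting_T : ∀ x α u, IsSplitting p.1 u → (∀ β < α, IsSplitting (U x β).1 u) →
    IsSplitting (T x α).1 u
  isStem : ∀ x α, IsStem (T x α).1 (stem (T x α))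
  next_injective : ∀ x α, Function.Injective (next α (T x α))
  next_mem : ∀ x α m, next α (T x α) m ∈ sucSet (T x α).1 (stem (T x α))
  card_next : ∀ x α, range (next α (T x α)) ≠ sucSet (T x α).1 (stem (T x α)) →
    #(range (next α (T x α))) < #(sucSet (T x α).1 (stem (T x α)))
  decides : ∀ x α, ∀ ξ ≤ Order.succ α, ∃ v, D.rel ξ v (U x α)
  T_congr : ∀ {x y α}, (∀ β < α, x β = y β) → T x α = T y α
  U_congr : ∀ {x y α}, (∀ β ≤ α, x β = y β) → U x α = U y α

section Construction

variable {V : Type u} (D : Decides h V) (p : SForcing h)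

open Classical in
/-- The stem of a condition. -/
noncomputable def stemOf (S : SForcing h) : Node κ :=
  if hS : ∃ s, IsStem S.1 s then hS.choose else S.2.nonempty.some

theorem isStem_stemOf [Fact κ.IsInaccessible] (S : SForcing h) : IsStem S.1 (stemOf S) := by
  have hS := S.2.exists_isStem
  rw [stemOf, dif_pos hS]
  exact hS.choose_spec

open Classical in
/-- A choice of immediate successors of the stem. -/
noncomputable def nextOf (α : Below κ) (S : SForcing h) : Index h α → Node κ :=
  if hS : max 2 (h α) ≤ #(sucSet S.1 (stemOf S)) then (exists_index_embedding hS).choose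
  else fun _ => stemOf S

theorem nextOf_spec {α : Below κ} {S : SForcing h} (hS : max 2 (h α) ≤ #(sucSet S.1 (stemOf S))) :
    Function.Injective (nextOf α S) ∧ range (nextOf α S) ⊆ sucSet S.1 (stemOf S) ∧
      (range (nextOf α S) ≠ sucSet S.1 (stemOf S) →
        #(range (nextOf α S)) < #(sucSet S.1 (stemOf S))) := by
  rw [nextOf, dif_pos hS]
  exact (exists_index_embedding hS).choose_spec

/-- The requirements on the condition chosen below a successor of the stem of `S`. -/
def IsStep (α : Below κ) (m : Index h α) (S q : SForcing h) : Prop :=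
  q ≤ S ∧ q.1 ⊆ cone S.1 (nextOf α S m) ∧ CardAfter h α q.1 ∧
    ∀ ξ ≤ Order.succ α, ∃ v, D.rel ξ v q

theorem exists_isStep [Fact κ.IsInaccessible] (hh : Monotone h) {α : Below κ} {m : Index h α}
    {S : SForcing h} (hS : nextOf α S m ∈ S.1) : ∃ q, IsStep D α m S q := by
  obtain ⟨q, hq, hq'⟩ := D.exists_le_cardAfter hh (S.cone hh _ hS) α (Order.succ α)
  exact ⟨q, hq.trans (S.cone_le hh _ hS), hq.1, hq'⟩

open Classical in
/-- The choice of a condition as in `IsStep`. -/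
noncomputable def stepOf (α : Below κ) (m : Index h α) (S : SForcing h) : SForcing h :=
  if hq : ∃ q, IsStep D α m S q then hq.choose else S

theorem isStep_stepOf {α : Below κ} {m : Index h α} {S : SForcing h} (hq : ∃ q, IsStep D α m S q) :
    IsStep D α m S (stepOf D α m S) := by
  rw [stepOf, dif_pos hq]
  exact hq.choose_spec

/-- The sequence `g` of conditions with `p` added in front. -/
def consSeq {α : Below κ} (g : (β : Below κ) → β < α → SForcing h) :
    Option (Iio α) → SForcing h
  | none => p
  | some β => g β.1 β.2

open Classical in
/-- The intersection of `p` and a sequence of conditions. -/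
noncomputable def limOf {α : Below κ} (g : (β : Below κ) → β < α → SForcing h) : SForcing h :=
  if hg : IsCondition h (⋂ i, (consSeq p g i).1) then ⟨_, hg⟩ else p

/-- The recursive definition of the conditions `U x α`. -/
noncomputable def fusionU (x : ∀ α, Index h α) : Below κ → SForcing h :=
  wellFounded_lt.fix fun α g => stepOf D α (x α) (limOf p g)

/-- The conditions `T x α`. -/
noncomputable def fusionT (x : ∀ α, Index h α) (α : Below κ) : SForcing h :=
  limOf p fun (β : Below κ) (_ : β < α) => fusionU D p x β

theorem fusionU_eq (x : ∀ α, Index h α) (α : Below κ) :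
    fusionU D p x α = stepOf D α (x α) (fusionT D p x α) :=
  wellFounded_lt.fix_eq _ α

theorem fusionU_congr {x y : ∀ α, Index h α} {α : Below κ} (hxy : ∀ β ≤ α, x β = y β) :
    fusionU D p x α = fusionU D p y α := by
  induction α using WellFoundedLT.induction with
  | ind α ih =>
    have hT : fusionT D p x α = fusionT D p y α := by
      unfold fusionT
      congr 1
      funext β hβ
      exact ih β hβ fun γ hγ => hxy γ (hγ.trans hβ.le)
    rw [fusionU_eq, fusionU_eq, hT, hxy α le_rfl]

theorem fusionT_congr {x y : ∀ α, Index h α} {α : Below κ} (hxy : ∀ β < α, x β = y β) :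
    fusionT D p x α = fusionT D p y α := by
  unfold fusionT
  congr 1
  funext β hβ
  exact fusionU_congr D p fun γ hγ => hxy γ (hγ.trans_lt hβ)

variable {D p}

theorem mk_option_Iio_lt [hκ : Fact κ.IsInaccessible] (α : Below κ) : #(Option (Iio α)) < κ := by
  rw [mk_option]
  exact add_lt_of_lt hκ.out.1.le (mk_Iio_below_lt α) (one_lt_aleph0.trans hκ.out.1)

/-- One simultaneous induction is needed: the earlier stages must form a chain for `T x α` to be
their intersection, and its stem must have `h α` successors before the next step can be taken. -/
theorem fusion_spec [Fact κ.IsInaccessible] (hh : Monotone h) (x : ∀ α, Index h α) (α : Below κ) :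
    (fusionT D p x α ≤ p ∧ (∀ β < α, fusionT D p x α ≤ fusionU D p x β)) ∧
    (∀ u, IsSplitting p.1 u → (∀ β < α, IsSplitting (fusionU D p x β).1 u) →
      IsSplitting (fusionT D p x α).1 u) ∧
    max 2 (h α) ≤ #(sucSet (fusionT D p x α).1 (stemOf (fusionT D p x α))) ∧
    IsStep D α (x α) (fusionT D p x α) (fusionU D p x α) := by
  induction α using WellFoundedLT.induction with
  | ind α ih =>
    set g : (β : Below κ) → β < α → SForcing h := fun β _ => fusionU D p x β with hg
    have hUp : ∀ β < α, fusionU D p x β ≤ p := fun β hβ =>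
      (ih β hβ).2.2.2.1.trans (ih β hβ).1.1
    have hUU : ∀ β γ, β < γ → γ < α → fusionU D p x γ ≤ fusionU D p x β := fun β γ hβγ hγ =>
      (ih γ hγ).2.2.2.1.trans ((ih γ hγ).1.2 β hβγ)
    have hchain : ∀ i j, consSeq p g i ≤ consSeq p g j ∨ consSeq p g j ≤ consSeq p g i := by
      rintro (_ | β) (_ | γ)
      · exact Or.inl le_rfl
      · exact Or.inr (hUp _ γ.2)
      · exact Or.inl (hUp _ β.2)
      · rcases lt_trichotomy β.1 γ.1 with hlt | heq | hlt
        · exact Or.inr (hUU _ _ hlt γ.2)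
        · exact Or.inl (by rw [Subtype.ext heq])
        · exact Or.inl (hUU _ _ hlt β.2)
    have hT : fusionT D p x α = SForcing.iInter hh (mk_option_Iio_lt α) (consSeq p g) hchain :=
      dif_pos (isCondition_iInter hh (mk_option_Iio_lt α) (consSeq p g) hchain)
    have hT' : (fusionT D p x α).1 = ⋂ i, (consSeq p g i).1 := by rw [hT]; rfl
    have hle : ∀ i, fusionT D p x α ≤ consSeq p g i := by
      rw [hT]
      exact SForcing.iInter_le hh _ _ hchain
    have hs : IsStem _ _ := isStem_stemOf (fusionT D p x α)
    set s := stemOf (fusionT D p x α) with hs_def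
    have hstem : ∀ β < α, IsStem (fusionT D p x β).1 (stemOf (fusionT D p x β)) :=
      fun β _ => isStem_stemOf _
    have hlt : ∀ β < α, ∀ u, IsSplitting (fusionU D p x β).1 u → stemOf (fusionT D p x β) < u := by
      intro β hβ u hu
      have h1 := nextOf_spec (ih β hβ).2.2.1
      have h2 := hu.mono (ih β hβ).2.2.2.2.1
      exact (lt_of_mem_sucSet (h1.2.1 ⟨x β, rfl⟩)).trans_le (isSplitting_cone_iff.1 h2).2
    have hsα : ∀ β < α, stemOf (fusionT D p x β) < s := fun β hβ =>
      hlt β hβ s (hs.1.mono (hle (some ⟨β, hβ⟩)).1)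
    have hsmono : ∀ β γ, β < γ → γ < α → stemOf (fusionT D p x β) < stemOf (fusionT D p x γ) :=
      fun β γ hβγ hγ => hlt β (hβγ.trans hγ) _ ((hstem γ hγ).1.mono ((ih γ hγ).1.2 β hβγ).1)
    have hcard : max 2 (h α) ≤ #(sucSet (fusionT D p x α).1 s) := by
      refine max_le hs.1.2 ?_
      have hsi : ∀ i, IsSplitting (consSeq p g i).1 s := fun i => hs.1.mono (hle i).1
      obtain ⟨i, hi⟩ := exists_sucSet_iInter_eq _ hchain hsi
      rw [hT', hi]
      -- By stabilisation the stem has the same successors as in `p` or in some `U x β`. In `p` all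
      -- earlier stems count below it; in `U x β` only those with index between `β` and `α`, which
      -- is what `CardAfter` is made for.
      rcases i with _ | β
      · exact p.2.card_le hh (hsi none) ⟨fun β => stemOf (fusionT D p x β),
          fun β γ hβγ => hsmono _ _ hβγ γ.2,
          fun β => ⟨(hstem _ β.2).1.mono (ih _ β.2).1.1.1, hsα _ β.2⟩⟩
      · exact (ih β.1 β.2).2.2.2.2.2.1 α s (hsi (some β)) ⟨fun γ => stemOf (fusionT D p x γ),
          fun γ δ hγδ => hsmono _ _ hγδ δ.2.2,
          fun γ => ⟨(hstem _ γ.2.2).1.mono ((ih _ γ.2.2).1.2 β.1 γ.2.1).1, hsα _ γ.2.2⟩⟩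
    refine ⟨⟨hle none, fun β hβ => hle (some ⟨β, hβ⟩)⟩, fun u hu hu' => ?_, hcard, ?_⟩
    · rw [hT', isSplitting_iInter_iff _ hchain]
      rintro (_ | β)
      · exact hu
      · exact hu' _ β.2
    · rw [fusionU_eq]
      exact isStep_stepOf D (exists_isStep D hh ((nextOf_spec hcard).2.1 ⟨x α, rfl⟩).1)

/-- The fusion system given by recursion. -/
noncomputable def fusionSystem [Fact κ.IsInaccessible] (hh : Monotone h) (D : Decides h V)
    (p : SForcing h) : FusionSystem D p where
  T := fusionT D p
  U := fusionU D p
  stem := stemOf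
  next := nextOf
  T_le x α := (fusion_spec hh x α).1.1
  T_le_U x {α β} := (fusion_spec hh x α).1.2 β
  U_le x α := (fusion_spec hh x α).2.2.2.1
  U_subset x α := (fusion_spec hh x α).2.2.2.2.1
  splitting_T x α := (fusion_spec hh x α).2.1
  isStem _ _ := isStem_stemOf _
  next_injective x α := (nextOf_spec (fusion_spec hh x α).2.2.1).1
  next_mem x α m := (nextOf_spec (fusion_spec hh x α).2.2.1).2.1 ⟨m, rfl⟩
  card_next x α := (nextOf_spec (fusion_spec hh x α).2.2.1).2.2
  decides x α := (fusion_spec hh x α).2.2.2.2.2.2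
  T_congr := fusionT_congr D p
  U_congr := fusionU_congr D p

end Construction

namespace FusionSystem

variable {V : Type u} {D : Decides h V} {p : SForcing h} (F : FusionSystem D p)
  {x y : ∀ α, Index h α} {α β : Below κ}

/-- The stem of `T x α`. -/
def s (x : ∀ α, Index h α) (α : Below κ) : Node κ := F.stem (F.T x α)

/-- The immediate successor of the stem of `T x α` given by `x α`. -/
def w (x : ∀ α, Index h α) (α : Below κ) : Node κ := F.next α (F.T x α) (x α)

theorem s_congr (hxy : ∀ γ < α, x γ = y γ) : F.s x α = F.s y α := by
  rw [s, s, F.T_congr hxy]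

theorem w_mem : F.w x α ∈ sucSet (F.T x α).1 (F.s x α) := F.next_mem x α _

theorem s_lt_w : F.s x α < F.w x α := lt_of_mem_sucSet F.w_mem

theorem T_anti (hαβ : α ≤ β) : F.T x β ≤ F.T x α := by
  rcases hαβ.eq_or_lt with rfl | hlt
  · exact le_rfl
  · exact (F.T_le_U x hlt).trans (F.U_le x α)

theorem w_le_s (hαβ : α < β) : F.w x α ≤ F.s x β :=
  (isSplitting_cone_iff.1 ((F.isStem x β).1.mono ((F.T_le_U x hαβ).1.trans (F.U_subset x α)))).2

theorem s_strictMono : StrictMono (F.s x) := fun _ _ hαβ => F.s_lt_w.trans_le (F.w_le_s hαβ)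

theorem eq_of_w_le {z : Node κ} (hxy : ∀ γ < α, x γ = y γ) (hx : F.w x α ≤ z) (hy : F.w y α ≤ z) :
    x α = y α := by
  have h1 : F.s x α = F.s y α := F.s_congr hxy
  have h2 : F.w x α ∈ sucSet (F.T x α).1 (F.s y α) := h1 ▸ F.w_mem
  have h3 : F.w x α = F.w y α := eq_of_mem_sucSet_of_le h2 F.w_mem hx hy
  rw [w, w, F.T_congr hxy] at h3
  exact F.next_injective y α h3

/-- Distinct chosen successors of one stem are incomparable, so branches whose stems lie on a common
path make the same choices, level by level. -/
theorem agree_of_le {z : Node κ} (hx : F.s x α ≤ z) (hy : F.s y β ≤ z) {γ : Below κ} (hα : γ < α)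
    (hβ : γ < β) : x γ = y γ := by
  induction γ using WellFoundedLT.induction with
  | ind γ ih =>
    exact F.eq_of_w_le (fun δ hδ => ih δ hδ (hδ.trans hα) (hδ.trans hβ))
      ((F.w_le_s hα).trans hx) ((F.w_le_s hβ).trans hy)

theorem le_of_s_le (hxy : F.s x α ≤ F.s y β) : α ≤ β := by
  by_contra! hlt
  have h1 : F.s x β = F.s y β := F.s_congr fun γ hγ => F.agree_of_le hxy le_rfl (hγ.trans hlt) hγ
  exact absurd (F.s_strictMono hlt) (h1 ▸ not_lt_of_ge hxy)

theorem agree_of_s_le (hxy : F.s x α ≤ F.s y β) : ∀ γ < α, x γ = y γ := fun _ hγ =>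
  F.agree_of_le hxy le_rfl hγ (hγ.trans_le (F.le_of_s_le hxy))

/-- The fusion: the tree generated by the stems. -/
def tree : Set (Node κ) := {u | ∃ x α, u ≤ F.s x α}

theorem s_mem_tree : F.s x α ∈ F.tree := ⟨x, α, le_rfl⟩

theorem T_eq_of_s_le (hxy : F.s x α ≤ F.s y β) : F.T x α = F.T y α := F.T_congr (F.agree_of_s_le hxy)

theorem sucSet_tree [Fact κ.IsInaccessible] :
    sucSet F.tree (F.s x α) = range (F.next α (F.T x α)) := by
  classical
  ext a
  constructor
  · rintro ⟨⟨y, β, hay⟩, hxa, hc⟩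
    have hlt : F.s x α < a := Node.lt_of_covBy hxa hc
    have hxy : F.s x α ≤ F.s y β := hlt.le.trans hay
    have hT : F.T x α = F.T y α := F.T_eq_of_s_le hxy
    have hs : F.s x α = F.s y α := F.s_congr (F.agree_of_s_le hxy)
    have hαβ : α < β := by
      refine lt_of_le_of_ne (F.le_of_s_le hxy) ?_
      rintro rfl
      exact absurd hay (hs ▸ not_le_of_gt hlt)
    refine ⟨y α, ?_⟩
    rw [hT]
    have h1 : F.w y α ∈ sucSet (F.T y α).1 (F.s x α) := hs ▸ F.w_mem
    exact eq_of_mem_sucSet_of_le (T := (F.T y α).1) (S := univ) h1 ⟨trivial, hxa, hc⟩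
      (F.w_le_s hαβ) hay
  · rintro ⟨m, rfl⟩
    -- Changing `x` at `α` alone preserves `T x α` and selects the successor numbered `m`, which
    -- lies below the next stem.
    refine ⟨⟨Function.update x α m, Order.succ α, ?_⟩, (F.next_mem x α m).2⟩
    have h1 : F.T x α = F.T (Function.update x α m) α := F.T_congr fun β hβ => by
      rw [Function.update_of_ne hβ.ne]
    have h2 := F.w_le_s (x := Function.update x α m) (Order.lt_succ α)
    rwa [w, Function.update_self, ← h1] at h2

/-- Two successors of a splitting node lie below stems of branches `x` and `y`, which must disagree
at a common level. They part at the stem of the first disagreement, and that stem can only be `u`.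
-/
theorem isSplitting_tree_iff [Fact κ.IsInaccessible] {u : Node κ} :
    IsSplitting F.tree u ↔ ∃ x α, u = F.s x α := by
  constructor
  · intro hu
    obtain ⟨a, ha, b, hb, hab⟩ := hu.exists_ne
    obtain ⟨x, α, hax⟩ := ha.1
    obtain ⟨y, β, hby⟩ := hb.1
    have hux : u < F.s x α := (lt_of_mem_sucSet ha).trans_le hax
    have huy : u < F.s y β := (lt_of_mem_sucSet hb).trans_le hby
    by_cases hagree : ∀ γ, γ < α → γ < β → x γ = y γ
    · refine (hab ?_).elim
      rcases le_total α β with hαβ | hβα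
      · have h1 : F.s x α = F.s y α := F.s_congr fun γ hγ => hagree γ hγ (hγ.trans_le hαβ)
        exact eq_of_mem_sucSet_of_le ha hb
          (hax.trans (h1 ▸ F.s_strictMono.monotone hαβ)) hby
      · have h1 : F.s x β = F.s y β := F.s_congr fun γ hγ => hagree γ (hγ.trans_le hβα) hγ
        exact eq_of_mem_sucSet_of_le ha hb hax
          (hby.trans (h1 ▸ F.s_strictMono.monotone hβα))
    · let A : Set (Below κ) := {γ | γ < α ∧ γ < β ∧ x γ ≠ y γ}
      have hA : A.Nonempty := by
        push Not at hagree
        exact hagree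
      obtain ⟨hδα, hδβ, hne⟩ := wellFounded_lt.min_mem A hA
      have hmin : ∀ γ < wellFounded_lt.min A hA, x γ = y γ := by
        intro γ hγ
        by_contra hγne
        exact wellFounded_lt.not_lt_min A (x := γ) ⟨hγ.trans hδα, hγ.trans hδβ, hγne⟩ hγ
      set δ := wellFounded_lt.min A hA
      have hs : F.s x δ = F.s y δ := F.s_congr hmin
      have hsx : F.s x δ < F.s x α := F.s_strictMono hδα
      have hsy : F.s x δ < F.s y β := hs ▸ F.s_strictMono hδβ
      refine ⟨x, δ, ?_⟩
      rcases Node.le_or_lt hsx.le hux.le with hle | hlt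
      · rcases hle.eq_or_lt with heq | hlt
        · exact heq.symm
        · refine (hne (F.eq_of_w_le (z := u) hmin ?_ ?_)).elim
          · exact Node.le_of_covBy F.w_mem.2.2 (F.w_le_s hδα) hux.le hlt
          · exact Node.le_of_covBy F.w_mem.2.2 (F.w_le_s hδβ) huy.le (hs ▸ hlt)
      · exact (hab (eq_of_mem_sucSet_of_le ha hb (Node.le_of_covBy ha.2.2 hax hsx.le hlt)
          (Node.le_of_covBy hb.2.2 hby hsy.le hlt))).elim
  · rintro ⟨x, α, rfl⟩
    refine ⟨F.s_mem_tree, ?_⟩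
    rw [sucSet_tree, mk_range_eq _ (F.next_injective x α), mk_index]
    exact le_max_left _ _

/-- The splitting nodes below `F.s x α` are the earlier stems of the same branch, so `max 2 (h α)`
successors suffice there. -/
theorem le_of_hasSplittingsBelow [Fact κ.IsInaccessible] {ξ : Below κ}
    (hξ : HasSplittingsBelow F.tree (Iio ξ) (F.s x α)) : ξ ≤ α := by
  obtain ⟨g, hg, hg'⟩ := hξ
  choose y γ hy using fun a => F.isSplitting_tree_iff.1 (hg' a).1
  have hle : ∀ a, F.s (y a) (γ a) ≤ F.s x α := fun a => hy a ▸ (hg' a).2.le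
  have hs : ∀ a, g a = F.s x (γ a) := fun a => (hy a).trans (F.s_congr (F.agree_of_s_le (hle a)))
  refine le_of_strictMono_Iio (f := fun a => ⟨γ a, ?_⟩) ?_
  · exact F.s_strictMono.lt_iff_lt.1 (hs a ▸ (hg' a).2)
  · intro a b hab
    have h1 := hg hab
    rw [hs, hs] at h1
    exact F.s_strictMono.lt_iff_lt.1 h1

/-- The branches involved agree on common levels, so one branch `y` carries all the nodes. If the
supremum `δ` of their levels is attained, the union is one of them. Otherwise it splits in `p` and
in every `U y β` with `β < δ`, hence in `T y δ`, which puts it above the stem of `T y δ`; the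
converse inequality is clear. -/
theorem isSplitting_tree_of_isUnion [Fact κ.IsInaccessible] {ι : Type u} [Nonempty ι] (hι : #ι < κ)
    {u : ι → Node κ} (hu : ∀ i, IsSplitting F.tree (u i)) {z : Node κ} (hz : Node.IsUnion u z) :
    IsSplitting F.tree z := by
  classical
  choose x α hx using fun i => F.isSplitting_tree_iff.1 (hu i)
  obtain ⟨i₀⟩ := ‹Nonempty ι›
  let y : ∀ α, Index h α := fun γ => if hγ : ∃ i, γ < α i then x hγ.choose γ else x i₀ γ
  have hy : ∀ i, ∀ γ < α i, x i γ = y γ := by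
    intro i γ hγ
    have hγ' : ∃ i, γ < α i := ⟨i, hγ⟩
    simp only [y, dif_pos hγ']
    exact F.agree_of_le (hx i ▸ hz.le i) (hx _ ▸ hz.le hγ'.choose) hγ hγ'.choose_spec
  have hu' : ∀ i, u i = F.s y (α i) := fun i => (hx i).trans (F.s_congr (hy i))
  obtain ⟨δ, hδ, hδ'⟩ := exists_lub_below hι α
  by_cases hmax : ∃ i, α i = δ
  · obtain ⟨i, hi⟩ := hmax
    have hzi : z = u i := le_antisymm (hz.le_of_forall_le fun j => by
      rw [hu' i, hu' j, hi]
      exact F.s_strictMono.monotone (hδ j)) (hz.le i)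
    rw [hzi]
    exact hu i
  · have hlt : ∀ i, α i < δ := fun i => lt_of_le_of_ne (hδ i) fun he => hmax ⟨i, he⟩
    have : Nonempty ι := ⟨i₀⟩
    refine F.isSplitting_tree_iff.2 ⟨y, δ, le_antisymm (hz.le_of_forall_le fun i => ?_) ?_⟩
    · rw [hu' i]
      exact (F.s_strictMono (hlt i)).le
    · refine (F.isStem y δ).le (F.splitting_T y δ z ?_ fun β hβ => ?_)
      · refine p.2.isSplitting_of_isUnion hι (fun i => ?_) hz
        rw [hu' i]
        exact (F.isStem y (α i)).1.mono (F.T_le y (α i)).1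
      · obtain ⟨j, hj⟩ := hδ' β hβ
        let J : Type u := {i // β < α i}
        have : Nonempty J := ⟨⟨j, hj⟩⟩
        refine (F.U y β).2.isSplitting_of_isUnion (ι := J) ((mk_subtype_le _).trans_lt hι)
          (u := fun i => u i.1) (fun i => ?_) (hz.of_cofinal ?_ fun i => ⟨i.1, le_rfl⟩)
        · rw [hu' i.1]
          exact (F.isStem y (α i.1)).1.mono (F.T_le_U y i.2).1
        · intro i
          rcases le_total (α i) (α j) with hij | hij
          · refine ⟨⟨j, hj⟩, ?_⟩
            rw [hu' i, hu' j]
            exact F.s_strictMono.monotone hij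
          · exact ⟨⟨i, hj.trans_le hij⟩, le_rfl⟩

theorem isCondition_tree [Fact κ.IsInaccessible] (hh : Monotone h) : IsCondition h F.tree := by
  have hne : ∀ α, Nonempty (Index h α) := fun α => by
    rw [← mk_ne_zero_iff, mk_index]
    exact (two_pos.trans_le (le_max_left _ _)).ne'
  refine IsCondition.of_hasSplittingsBelow ?_ ?_ ?_ ?_ ?_
  · obtain ⟨x, -⟩ := p.2.nonempty
    exact ⟨F.s (fun α => (hne α).some) x.len, F.s_mem_tree⟩
  · rintro u v huv ⟨x, α, hv⟩
    exact ⟨x, α, huv.trans hv⟩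
  · rintro u ⟨x, α, hu⟩
    exact ⟨_, hu, F.isSplitting_tree_iff.2 ⟨x, α, rfl⟩⟩
  · intro ξ u hu hξ
    obtain ⟨x, α, rfl⟩ := F.isSplitting_tree_iff.1 hu
    rw [sucSet_tree, mk_range_eq _ (F.next_injective x α), mk_index]
    exact (hh (F.le_of_hasSplittingsBelow hξ)).trans (le_max_right _ _)
  · intro ι u hne hι hu z hz
    exact F.isSplitting_tree_of_isUnion hι hu hz

/-- The fusion as a condition. -/
def fused [Fact κ.IsInaccessible] (hh : Monotone h) : SForcing h := ⟨F.tree, F.isCondition_tree hh⟩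

theorem mem_T_of_s_le {v : Node κ} (hv : v ∈ F.tree) (hxv : F.s x α ≤ v) : v ∈ (F.T x α).1 := by
  obtain ⟨y, β, hy⟩ := hv
  have hxy := hxv.trans hy
  rw [F.T_eq_of_s_le hxy]
  exact (F.T y α).2.mem_of_le hy ((F.T_anti (F.le_of_s_le hxy)).1 (F.isStem y β).1.1)

/-- Either the fusion keeps all successors in `T x α`, and the order between `T x α` and `S`
applies, or it keeps strictly fewer than `T x α` has. -/
theorem sucSet_tree_cases [Fact κ.IsInaccessible] (S : SForcing h) (hS : F.T x α ≤ S)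
    (hne : sucSet F.tree (F.s x α) ≠ sucSet S.1 (F.s x α)) :
    #(sucSet F.tree (F.s x α)) < #(sucSet S.1 (F.s x α)) := by
  have hs := (F.isStem x α).1
  rw [sucSet_tree] at hne ⊢
  by_cases he : range (F.next α (F.T x α)) = sucSet (F.T x α).1 (F.s x α)
  · rw [he] at hne ⊢
    exact hS.2 _ hs hne
  · exact (F.card_next x α he).trans_le (mk_le_mk_of_subset (sucSet_mono hS.1 _))

theorem fused_le [Fact κ.IsInaccessible] (hh : Monotone h) : F.fused hh ≤ p := by
  refine ⟨?_, fun u hu hne => ?_⟩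
  · rintro u ⟨x, α, hu⟩
    exact p.2.mem_of_le hu ((F.T_le x α).1 (F.isStem x α).1.1)
  · obtain ⟨x, α, rfl⟩ := F.isSplitting_tree_iff.1 hu
    exact F.sucSet_tree_cases p (F.T_le x α) hne

/-- A splitting node of `r` with a copy of `α + 1` below it is a stem of level `β > α`. Above this
stem the fusion is contained in `T x β`, so the cone of `r` there is the required extension. -/
theorem exists_le_U [Fact κ.IsInaccessible] (hh : Monotone h) {r : SForcing h}
    (hr : r ≤ F.fused hh) (α : Below κ) : ∃ x, ∃ r' ≤ r, r' ≤ F.U x α := by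
  obtain ⟨v, hv⟩ := r.2.nonempty
  obtain ⟨g, hg, hg'⟩ := r.2.exists_strictMono_splitting hv
  have hu := (hg' (Order.succ α)).1
  obtain ⟨x, β, hx⟩ := F.isSplitting_tree_iff.1 (hu.mono hr.1)
  have hαβ : α < β := by
    refine (Order.lt_succ α).trans_le (F.le_of_hasSplittingsBelow (x := x) ?_)
    rw [← hx]
    exact ⟨fun a => g a, fun a b hab => hg hab, fun a => ⟨(hg' _).1.mono hr.1, hg a.2⟩⟩
  rw [hx] at hu
  refine ⟨x, r.cone hh _ hu.1, r.cone_le hh _ _, le_trans ?_ (F.T_le_U x hαβ)⟩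
  refine ⟨?_, fun z hz hne => ?_⟩
  · rintro z ⟨hz, hle | hle⟩
    · exact (F.T x β).2.mem_of_le hle (F.isStem x β).1.1
    · exact F.mem_T_of_s_le (hr.1 hz) hle
  · obtain ⟨hzr, hxz⟩ := isSplitting_cone_iff.1 hz
    change sucSet (cone r.1 _) z ≠ _ at hne
    change #(sucSet (cone r.1 _) z) < _
    rw [sucSet_cone hxz] at hne ⊢
    obtain ⟨y, γ, rfl⟩ := F.isSplitting_tree_iff.1 (hzr.mono hr.1)
    have hT : F.T y γ ≤ F.T x β := by
      rw [F.T_eq_of_s_le hxz]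
      exact F.T_anti (F.le_of_s_le hxz)
    by_cases he : sucSet r.1 (F.s y γ) = sucSet F.tree (F.s y γ)
    · rw [he] at hne ⊢
      exact F.sucSet_tree_cases _ hT hne
    · refine (hr.2 _ hzr he).trans_le (mk_le_mk_of_subset ?_)
      change sucSet F.tree _ ⊆ _
      rw [sucSet_tree]
      rintro _ ⟨m, rfl⟩
      exact sucSet_mono hT.1 _ (F.next_mem y γ m)

theorem mk_range_U_le (α : Below κ) : #(range fun x => F.U x α) ≤ prod fun β : Iic α => max 2 (h β) := by
  classical
  have hne : ∀ α, Nonempty (Index h α) := fun α => by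
    rw [← mk_ne_zero_iff, mk_index]
    exact (two_pos.trans_le (le_max_left _ _)).ne'
  let ext : (∀ β : Iic α, Index h β.1) → ∀ β, Index h β := fun x β =>
    if hβ : β ≤ α then x ⟨β, hβ⟩ else (hne β).some
  have hsub : (range fun x => F.U x α) ⊆ range fun x => F.U (ext x) α := by
    rintro _ ⟨x, rfl⟩
    refine ⟨fun β => x β, F.U_congr fun β hβ => ?_⟩
    simp only [ext, dif_pos hβ]
  refine (mk_le_mk_of_subset hsub).trans (mk_range_le.trans ?_)
  rw [mk_pi]
  simp only [mk_index]
  exact le_rfl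

end FusionSystem

/-- The bound given by the fusion argument. -/
noncomputable def fusionBound (h : Below κ → Cardinal.{u}) (ξ : Below κ) : Cardinal.{u} :=
  open Classical in if IsMin ξ ∨ h ξ < 2 then 1 else h ξ ^ #(Iio ξ)

/-- `U x α` depends on the choices at all levels up to `α`, but decides values up to `α + 1`. For a
successor `ξ` its predecessor thus costs exactly `|ξ|` factors; at a limit, `ξ` is infinite and one
more factor is harmless. -/
theorem exists_covering_index [Fact κ.IsInaccessible] {ξ : Below κ} (hξ : ¬ IsMin ξ) :
    ∃ α ≤ ξ, ξ ≤ Order.succ α ∧ #(Iic α) = #(Iio ξ) := by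
  by_cases hlim : ∃ α, α ⋖ ξ
  · obtain ⟨α, hα⟩ := hlim
    refine ⟨α, hα.le, hα.succ_eq.ge, ?_⟩
    rw [← hα.succ_eq, Order.Iio_succ]
  · refine ⟨ξ, le_rfl, Order.le_succ ξ, ?_⟩
    have hinf : ℵ₀ ≤ #(Iio ξ) := by
      rw [aleph0_le_mk_iff]
      obtain ⟨β, hβ⟩ := not_isMin_iff.1 hξ
      have : Nonempty (Iio ξ) := ⟨⟨β, hβ⟩⟩
      have : NoMaxOrder (Iio ξ) := ⟨fun β => by
        by_contra! hcon
        refine hlim ⟨β.1, β.2, fun γ hβγ hγ => ?_⟩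
        exact absurd (hcon ⟨γ, hγ⟩) (not_le_of_gt hβγ)⟩
      infer_instance
    rw [← Iio_insert, mk_insert (by simp)]
    exact add_one_eq hinf

/-- The fusion theorem. -/
theorem exists_slalom [hκ : Fact κ.IsInaccessible] (hh : IsCardFun h) {V : Type u} (D : Decides h V)
    (p : SForcing h) : ∃ φ : Below κ → Set V, (∀ ξ, #(φ ξ) ≤ fusionBound h ξ) ∧
      ∃ q ≤ p, ∀ ξ, ∀ r ≤ q, ∃ r' ≤ r, ∃ v ∈ φ ξ, D.rel ξ v r' := by
  classical
  -- The values up to `η` are decided before the fusion. They include the least argument and all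
  -- those with `h ξ < 2`, where the factors `max 2 (h β)` could not be bounded by `h ξ`.
  obtain ⟨η, hη⟩ := hh.cofinal 2 (hκ.out.nat_lt 2)
  obtain ⟨p₀, hp₀, hdec⟩ := D.exists_le hh.mono p η
  let F := fusionSystem hh.mono D p₀
  have hcases : ∀ ξ, ∃ A : Set V, #A ≤ fusionBound h ξ ∧
      ∀ r ≤ F.fused hh.mono, ∃ r' ≤ r, ∃ v ∈ A, D.rel ξ v r' := by
    intro ξ
    by_cases hξ : IsMin ξ ∨ h ξ < 2
    · have hξη : ξ ≤ η := by
        rcases hξ with hmin | hlt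
        · exact (le_total ξ η).elim id fun hle => hmin hle
        · by_contra! hcon
          exact absurd (hη.trans (hh.mono hcon.le)) (not_le_of_gt hlt)
      obtain ⟨v, hv⟩ := hdec ξ hξη
      refine ⟨{v}, ?_, fun r hr => ⟨r, le_rfl, v, rfl, D.mono (hr.trans (F.fused_le hh.mono)) hv⟩⟩
      rw [fusionBound, if_pos hξ, mk_singleton]
    · rw [fusionBound, if_neg hξ]
      rw [not_or, not_lt] at hξ
      obtain ⟨α, hαξ, hξα, hcard⟩ := exists_covering_index hξ.1
      obtain ⟨v₀, -⟩ : ∃ v : V, True := by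
        obtain ⟨_, _, v, _⟩ := D.dense ξ p
        exact ⟨v, trivial⟩
      let c : SForcing h → V := fun q => if hq : ∃ v, D.rel ξ v q then hq.choose else v₀
      refine ⟨c '' range fun x => F.U x α, ?_, fun r hr => ?_⟩
      · refine mk_image_le.trans ((F.mk_range_U_le α).trans ?_)
        refine (prod_le_prod _ (fun _ => h ξ) fun β => ?_).trans ?_
        · exact max_le hξ.2 (hh.mono (le_trans β.2 hαξ))
        · rw [prod_const', hcard]
      · obtain ⟨x, r', hr', hU⟩ := F.exists_le_U hh.mono hr α
        have hx := F.decides x α ξ hξα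
        refine ⟨r', hr', c (F.U x α), ⟨_, ⟨x, rfl⟩, rfl⟩, D.mono hU ?_⟩
        simp only [c, dif_pos hx]
        exact hx.choose_spec
  choose φ hφ hφ' using hcases
  exact ⟨φ, hφ, F.fused hh.mono, (F.fused_le hh.mono).trans hp₀, hφ'⟩

/-! ### Basic properties of the forcing relation -/

section Forcing

variable {P : Type u} [Preorder P] {a b c d x f A B : PName P} {p q : P}

theorem ForcesEq.mono (hqp : q ≤ p) (hab : ForcesEq a b p) : ForcesEq a b q := by
  cases a; cases b
  exact ⟨fun i r hr => hab.1 i r (hr.trans hqp), fun j r hr => hab.2 j r (hr.trans hqp)⟩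

theorem ForcesEq.of_dense (hab : ∀ q ≤ p, ∃ r ≤ q, ForcesEq a b r) : ForcesEq a b p := by
  cases a; cases b
  refine ⟨fun i q hq hi => ?_, fun j q hq hj => ?_⟩
  · obtain ⟨r, hr, hr'⟩ := hab q hq
    obtain ⟨s, hs, hs'⟩ := hr'.1 i r le_rfl (hr.trans hi)
    exact ⟨s, hs.trans hr, hs'⟩
  · obtain ⟨r, hr, hr'⟩ := hab q hq
    obtain ⟨s, hs, hs'⟩ := hr'.2 j r le_rfl (hr.trans hj)
    exact ⟨s, hs.trans hr, hs'⟩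

theorem ForcesEq.refl (a : PName P) (p : P) : ForcesEq a a p := by
  induction a generalizing p with
  | mk ι s n ih => exact ⟨fun i q _ hi => ⟨q, le_rfl, i, hi, ih i q⟩,
      fun i q _ hi => ⟨q, le_rfl, i, hi, ih i q⟩⟩

theorem ForcesEq.symm (hab : ForcesEq a b p) : ForcesEq b a p := by
  induction a generalizing b p with
  | mk ι s n ih =>
    cases b
    refine ⟨fun j q hq hj => ?_, fun i q hq hi => ?_⟩
    · obtain ⟨r, hr, i, hi, hij⟩ := hab.2 j q hq hj
      exact ⟨r, hr, i, hi, ih i hij⟩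
    · obtain ⟨r, hr, j, hj, hij⟩ := hab.1 i q hq hi
      exact ⟨r, hr, j, hj, ih i hij⟩

theorem ForcesEq.trans (hab : ForcesEq a b p) (hbc : ForcesEq b c p) : ForcesEq a c p := by
  induction a generalizing b c p with
  | mk ι s n ih =>
    cases b; cases c
    refine ⟨fun i q hq hi => ?_, fun k q hq hk => ?_⟩
    · obtain ⟨r, hr, j, hj, hij⟩ := hab.1 i q hq hi
      obtain ⟨t, ht, k, hk, hjk⟩ := hbc.1 j r (hr.trans hq) hj
      exact ⟨t, ht.trans hr, k, hk, ih i (hij.mono ht) hjk⟩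
    · obtain ⟨r, hr, j, hj, hjk⟩ := hbc.2 k q hq hk
      obtain ⟨t, ht, i, hi, hij⟩ := hab.2 j r (hr.trans hq) hj
      exact ⟨t, ht.trans hr, i, hi, ih i hij (hjk.mono ht)⟩

theorem ForcesMem.mono (hqp : q ≤ p) (hab : ForcesMem a b p) : ForcesMem a b q := by
  cases b
  exact fun r hr => hab r (hr.trans hqp)

theorem ForcesMem.congr_left (hab : ForcesEq a b p) (hac : ForcesMem a c p) : ForcesMem b c p := by
  cases c
  intro q hq
  obtain ⟨r, hr, j, hj, he⟩ := hac q hq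
  exact ⟨r, hr, j, hj, (hab.symm.mono (hr.trans hq)).trans he⟩

theorem ForcesMem.congr_right (hbc : ForcesEq b c p) (hab : ForcesMem a b p) : ForcesMem a c p := by
  cases b; cases c
  intro q hq
  obtain ⟨r, hr, j, hj, he⟩ := hab q hq
  obtain ⟨t, ht, k, hk, he'⟩ := hbc.1 j r (hr.trans hq) hj
  exact ⟨t, ht.trans hr, k, hk, (he.mono ht).trans he'⟩

theorem forcesMem_upair_iff :
    ForcesMem x (.upair a b) p ↔ ∀ q ≤ p, ∃ r ≤ q, ForcesEq x a r ∨ ForcesEq x b r := by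
  constructor
  · intro hx q hq
    obtain ⟨r, hr, ⟨⟨_ | _⟩, s⟩, -, hj⟩ := hx q hq
    · exact ⟨r, hr, Or.inr hj⟩
    · exact ⟨r, hr, Or.inl hj⟩
  · intro hx q hq
    obtain ⟨r, hr, he | he⟩ := hx q hq
    · exact ⟨r, hr, ⟨⟨true⟩, r⟩, le_rfl, he⟩
    · exact ⟨r, hr, ⟨⟨false⟩, r⟩, le_rfl, he⟩

theorem ForcesEq.upair (hac : ForcesEq a c p) (hbd : ForcesEq b d p) :
    ForcesEq (.upair a b) (.upair c d) p := by
  refine ⟨?_, ?_⟩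
  · rintro ⟨⟨_ | _⟩, s⟩ q hq -
    · exact ⟨q, le_rfl, ⟨⟨false⟩, q⟩, le_rfl, hbd.mono hq⟩
    · exact ⟨q, le_rfl, ⟨⟨true⟩, q⟩, le_rfl, hac.mono hq⟩
  · rintro ⟨⟨_ | _⟩, s⟩ q hq -
    · exact ⟨q, le_rfl, ⟨⟨false⟩, q⟩, le_rfl, hbd.mono hq⟩
    · exact ⟨q, le_rfl, ⟨⟨true⟩, q⟩, le_rfl, hac.mono hq⟩

theorem ForcesEq.opair (hac : ForcesEq a c p) (hbd : ForcesEq b d p) :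
    ForcesEq (.opair a b) (.opair c d) p :=
  (hac.upair hac).upair (hac.upair hbd)

theorem forcesMem_upair_left : ForcesMem a (.upair a b) p :=
  forcesMem_upair_iff.2 fun q _ => ⟨q, le_rfl, Or.inl (.refl a q)⟩

theorem forcesMem_upair_right : ForcesMem b (.upair a b) p :=
  forcesMem_upair_iff.2 fun q _ => ⟨q, le_rfl, Or.inr (.refl b q)⟩

/-- Four successive extensions decide which member of the other pair each of the four names equals.
-/
theorem ForcesEq.exists_of_upair (he : ForcesEq (.upair a b) (.upair c d) p) :
    ∃ r ≤ p, (ForcesEq a c r ∧ ForcesEq b d r) ∨ (ForcesEq a d r ∧ ForcesEq b c r) := by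
  obtain ⟨r₁, h₁, ha⟩ :=
    forcesMem_upair_iff.1 (ForcesMem.congr_right he forcesMem_upair_left) p le_rfl
  obtain ⟨r₂, h₂, hb⟩ :=
    forcesMem_upair_iff.1 (ForcesMem.congr_right he forcesMem_upair_right) r₁ h₁
  obtain ⟨r₃, h₃, hc⟩ :=
    forcesMem_upair_iff.1 (ForcesMem.congr_right he.symm forcesMem_upair_left) r₂ (h₂.trans h₁)
  obtain ⟨r, h₄, hd⟩ := forcesMem_upair_iff.1
    (ForcesMem.congr_right he.symm forcesMem_upair_right) r₃ (h₃.trans (h₂.trans h₁))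
  replace ha := ha.imp (ForcesEq.mono (h₄.trans (h₃.trans h₂))) (ForcesEq.mono (h₄.trans (h₃.trans h₂)))
  replace hb := hb.imp (ForcesEq.mono (h₄.trans h₃)) (ForcesEq.mono (h₄.trans h₃))
  replace hc := hc.imp (ForcesEq.mono h₄) (ForcesEq.mono h₄)
  refine ⟨r, h₄.trans (h₃.trans (h₂.trans h₁)), ?_⟩
  rcases ha with ha | ha <;> rcases hb with hb | hb
  · refine Or.inl ⟨ha, ?_⟩
    rcases hd with hd | hd
    · exact (hb.trans ha.symm).trans hd.symm
    · exact hd.symm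
  · exact Or.inl ⟨ha, hb⟩
  · exact Or.inr ⟨ha, hb⟩
  · refine Or.inl ⟨?_, hb⟩
    rcases hc with hc | hc
    · exact hc.symm
    · exact (ha.trans hb.symm).trans hc.symm

theorem ForcesEq.exists_of_opair (he : ForcesEq (.opair a b) (.opair c d) p) :
    ∃ r ≤ p, ForcesEq a c r ∧ ForcesEq b d r := by
  obtain ⟨r, hr, ⟨h1, h2⟩ | ⟨h1, h2⟩⟩ := he.exists_of_upair
  · obtain ⟨s, hs, h3⟩ := h1.exists_of_upair
    obtain ⟨t, ht, h4⟩ := (h2.mono hs).exists_of_upair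
    have hac : ForcesEq a c t := (h3.elim And.left And.left).mono ht
    refine ⟨t, ht.trans (hs.trans hr), hac, ?_⟩
    rcases h4 with ⟨-, h5⟩ | ⟨h5, h6⟩
    · exact h5
    · exact (h6.trans hac.symm).trans h5
  · obtain ⟨s, hs, h3⟩ := h1.exists_of_upair
    obtain ⟨t, ht, h4⟩ := (h2.mono hs).exists_of_upair
    have hac : ForcesEq a c s := h3.elim And.left And.right
    have had : ForcesEq a d s := h3.elim And.right And.left
    have hbc : ForcesEq b c t := h4.elim And.right And.right
    exact ⟨t, ht.trans (hs.trans hr), hac.mono ht,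
      (hbc.trans (hac.symm.mono ht)).trans (had.mono ht)⟩

/-- Equality is forced as soon as it is forced densely often, so no final extension is needed. -/
theorem forcesEq_of_opair (he : ForcesEq (.opair a b) (.opair c d) p) :
    ForcesEq a c p ∧ ForcesEq b d p := by
  constructor <;>
  · refine ForcesEq.of_dense fun q hq => ?_
    obtain ⟨r, hr, h1, h2⟩ := (he.mono hq).exists_of_opair
    exact ⟨r, hr, by assumption⟩

/-! ### The names of ground model sets -/

theorem forcesMem_check_iff {y : PSet.{u}} : ForcesMem x (.check P y) p ↔
    ∀ q ≤ p, ∃ r ≤ q, ∃ i : y.Type, ForcesEq x (.check P (y.Func i)) r := by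
  obtain ⟨ι, A⟩ := y
  constructor
  · intro hx q hq
    obtain ⟨r, hr, j, -, he⟩ := hx q hq
    exact ⟨r, hr, j.1, he⟩
  · intro hx q hq
    obtain ⟨r, hr, i, he⟩ := hx q hq
    exact ⟨r, hr, (i, r), le_rfl, he⟩

theorem forcesEq_check_iff {y z : PSet.{u}} : ForcesEq (.check P y) (.check P z) p ↔ y.Equiv z := by
  induction y generalizing z p with
  | mk ι A ih =>
    obtain ⟨τ, B⟩ := z
    constructor
    · intro he
      refine ⟨fun i => ?_, fun j => ?_⟩
      · obtain ⟨r, -, j, -, hj⟩ := he.1 (i, p) p le_rfl le_rfl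
        exact ⟨j.1, (ih i).1 hj⟩
      · obtain ⟨r, -, i, -, hi⟩ := he.2 (j, p) p le_rfl le_rfl
        exact ⟨i.1, (ih i.1).1 hi⟩
    · intro he
      refine ⟨?_, ?_⟩
      · rintro ⟨i, s⟩ q - -
        obtain ⟨j, hj⟩ := he.1 i
        exact ⟨q, le_rfl, (j, q), le_rfl, (ih i).2 hj⟩
      · rintro ⟨j, s⟩ q - -
        obtain ⟨i, hi⟩ := he.2 j
        exact ⟨q, le_rfl, (i, q), le_rfl, (ih i).2 hi⟩

theorem forcesMem_check_of_mem {y z : PSet.{u}} (hyz : y ∈ z) :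
    ForcesMem (.check P y) (.check P z) p := by
  obtain ⟨i, hi⟩ := PSet.mem_def.1 hyz
  exact forcesMem_check_iff.2 fun q _ => ⟨q, le_rfl, i, forcesEq_check_iff.2 hi⟩

/-- The canonical name of an element of an ordinal. -/
noncomputable def ordName (P : Type u) {o : Ordinal.{u}} (α : o.ToType) : PName P :=
  .check P (Ordinal.toPSet α.toOrd)

theorem forcesMem_toPSet_iff {o : Ordinal.{u}} : ForcesMem x (.check P o.toPSet) p ↔
    ∀ q ≤ p, ∃ r ≤ q, ∃ α : o.ToType, ForcesEq x (ordName P α) r := by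
  rw [Ordinal.toPSet, forcesMem_check_iff]
  rfl

theorem forcesMem_ordName {o : Ordinal.{u}} (α : o.ToType) :
    ForcesMem (ordName P α) (.check P o.toPSet) p :=
  forcesMem_toPSet_iff.2 fun q _ => ⟨q, le_rfl, α, .refl _ _⟩

/-- The rank of the underlying set recovers the ordinal. -/
theorem eq_of_forcesEq_ordName {o : Ordinal.{u}} {α β : o.ToType}
    (he : ForcesEq (ordName P α) (ordName P β) p) : α = β := by
  have h1 := PSet.rank_congr (forcesEq_check_iff.1 he)
  rw [Ordinal.rank_toPSet, Ordinal.rank_toPSet] at h1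
  exact Ordinal.ToType.mk.symm.injective (Subtype.ext h1)

/-! ### The forcing language -/

theorem Forces.mono {φ : Fml P} (hqp : q ≤ p) (hφ : Forces p φ) : Forces q φ := by
  induction φ with
  | eq a b => exact ForcesEq.mono hqp hφ
  | mem a b => exact ForcesMem.mono hqp hφ
  | neg φ _ => exact fun r hr => hφ r (hr.trans hqp)
  | and φ ψ ih1 ih2 => exact ⟨ih1 hφ.1, ih2 hφ.2⟩
  | all φ ih => exact fun a => ih a (hφ a)

theorem forces_ex_iff {φ : PName P → Fml P} :
    Forces p (.ex φ) ↔ ∀ q ≤ p, ∃ r ≤ q, ∃ a, Forces r (φ a) := by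
  simp only [Fml.ex, Forces]
  push Not
  exact forall₂_congr fun q _ => ⟨fun ⟨a, r, hr, hφ⟩ => ⟨r, hr, a, hφ⟩, fun ⟨r, hr, a, hφ⟩ => ⟨a, r, hr, hφ⟩⟩

theorem forces_imp_iff {φ ψ : Fml P} :
    Forces p (.imp φ ψ) ↔ ∀ q ≤ p, Forces q φ → ∃ r ≤ q, Forces r ψ := by
  simp only [Fml.imp, Forces]
  push Not
  rfl

theorem Forces.exists_mem_of_isFun (hf : Forces p (.isFun f A B)) (hq : q ≤ p)
    (hab : ForcesMem (.opair a b) f q) : ∃ r ≤ q, ForcesMem a A r ∧ ForcesMem b B r := by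
  obtain ⟨r, hr, h1⟩ := forces_imp_iff.1 (hf.1 (.opair a b)) q hq hab
  obtain ⟨s, hs, a', h2⟩ := forces_ex_iff.1 h1 r le_rfl
  obtain ⟨t, ht, b', h3, h4, h5⟩ := forces_ex_iff.1 h2 s le_rfl
  obtain ⟨h6, h7⟩ := forcesEq_of_opair h5
  exact ⟨t, ht.trans (hs.trans hr), ForcesMem.congr_left h6.symm h3, ForcesMem.congr_left h7.symm h4⟩

theorem Forces.exists_value_of_isFun (hf : Forces p (.isFun f A B)) (hq : q ≤ p)
    (ha : ForcesMem a A q) : ∃ r ≤ q, ∃ b, ForcesMem (.opair a b) f r := by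
  obtain ⟨r, hr, h1⟩ := forces_imp_iff.1 (hf.2.1 a) q hq ha
  obtain ⟨s, hs, b, h2⟩ := forces_ex_iff.1 h1 r le_rfl
  exact ⟨s, hs.trans hr, b, h2⟩

theorem Forces.exists_forcesEq_of_isFun (hf : Forces p (.isFun f A B)) (hq : q ≤ p)
    (hb : ForcesMem (.opair a b) f q) (hc : ForcesMem (.opair a c) f q) :
    ∃ r ≤ q, ForcesEq b c r :=
  forces_imp_iff.1 (hf.2.2 a b c) q hq ⟨hb, hc⟩

theorem Forces.exists_preimage_of_isOnto (hf : Forces p (.isOnto f B)) (hq : q ≤ p)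
    (hb : ForcesMem b B q) : ∃ r ≤ q, ∃ a, ForcesMem (.opair a b) f r := by
  obtain ⟨r, hr, h1⟩ := forces_imp_iff.1 (hf b) q hq hb
  obtain ⟨s, hs, a, h2⟩ := forces_ex_iff.1 h1 r le_rfl
  exact ⟨s, hs.trans hr, a, h2⟩

end Forcing

/-! ### Names for functions with ordinal values -/

/-- The values at the arguments `a ξ` of a function forced by `p`. Conditions incompatible with `p`
count as deciding. -/
def decidesOfName {p : SForcing h} {f A : PName (SForcing h)} {o : Ordinal.{u}} (ho : o ≠ 0)
    (hf : Forces p (.isFun f A (.check _ o.toPSet))) (a : Below κ → PName (SForcing h))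
    (ha : ∀ ξ, ForcesMem (a ξ) A p) : Decides h o.ToType where
  -- Density is demanded below every condition, while `f` is known to be a function only below `p`;
  -- hence the second alternative.
  rel ξ v r := ForcesMem (.opair (a ξ) (ordName _ v)) f r ∨ ∀ s ≤ r, ¬ s ≤ p
  mono hqp hr := hr.imp (ForcesMem.mono hqp) fun hs s hsq => hs s (hsq.trans hqp)
  dense ξ q := by
    by_cases hq : ∃ s ≤ q, s ≤ p
    · obtain ⟨s, hsq, hsp⟩ := hq
      obtain ⟨r, hr, b, hb⟩ := hf.exists_value_of_isFun hsp ((ha ξ).mono hsp)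
      obtain ⟨t, ht, -, hbo⟩ := hf.exists_mem_of_isFun (hr.trans hsp) hb
      obtain ⟨z, hz, v, hv⟩ := forcesMem_toPSet_iff.1 hbo t le_rfl
      refine ⟨z, hz.trans (ht.trans (hr.trans hsq)), v, Or.inl ?_⟩
      exact ForcesMem.congr_left (ForcesEq.opair (.refl _ _) hv) (hb.mono (hz.trans ht))
    · obtain ⟨v⟩ := Ordinal.nonempty_toType_iff.2 ho
      push Not at hq
      exact ⟨q, le_rfl, v, Or.inr hq⟩

theorem exists_slalom_of_name [Fact κ.IsInaccessible] (hh : IsCardFun h) {p : SForcing h}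
    {f A : PName (SForcing h)} {o : Ordinal.{u}} (ho : o ≠ 0)
    (hf : Forces p (.isFun f A (.check _ o.toPSet))) (a : Below κ → PName (SForcing h))
    (ha : ∀ ξ, ForcesMem (a ξ) A p) :
    ∃ φ : Below κ → Set o.ToType, (∀ ξ, #(φ ξ) ≤ fusionBound h ξ) ∧ ∃ q ≤ p, ∀ ξ, ∀ r ≤ q,
      ∃ r' ≤ r, ∃ v ∈ φ ξ, ForcesMem (.opair (a ξ) (ordName _ v)) f r' := by
  obtain ⟨φ, hφ, q, hq, hq'⟩ := exists_slalom hh (decidesOfName ho hf a ha) p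
  refine ⟨φ, hφ, q, hq, fun ξ r hr => ?_⟩
  obtain ⟨r', hr', v, hv, hd | hd⟩ := hq' ξ r hr
  · exact ⟨r', hr', v, hv, hd⟩
  · exact absurd (hr'.trans (hr.trans hq)) (hd r' le_rfl)

/-! ### Cardinal arithmetic -/

theorem power_lt_of_isInaccessible (hκ : κ.IsInaccessible) {a b : Cardinal.{u}} (ha : a < κ)
    (hb : b < κ) : a ^ b < κ :=
  calc a ^ b ≤ (2 ^ a) ^ b := power_le_power_right (cantor a).le
    _ = 2 ^ (a * b) := by rw [power_mul]
    _ < κ := hκ.isStrongLimit.isStrongPrelimit (mul_lt_of_lt hκ.1.le ha hb)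

theorem one_le_mk_Iio {α : Below κ} (hα : ¬ IsMin α) : 1 ≤ #(Iio α) := by
  obtain ⟨β, hβ⟩ := not_isMin_iff.1 hα
  exact Cardinal.one_le_iff_ne_zero.2 (mk_ne_zero_iff.2 ⟨⟨β, hβ⟩⟩)

theorem mk_Iio_of_isMin {α : Below κ} (hα : IsMin α) : #(Iio α) = 0 := by
  rw [mk_eq_zero_iff]
  exact ⟨fun β => not_lt_of_ge (hα (le_of_lt β.2)) β.2⟩

theorem isCardFun_powFun [hκ : Fact κ.IsInaccessible] (hh : IsCardFun h)
    (h0 : ∀ α, ¬ IsMin α → h α ≠ 0) : IsCardFun (powFun h) where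
  lt α := power_lt_of_isInaccessible hκ.out (hh.lt α) (mk_Iio_below_lt α)
  mono := by
    intro α β hαβ
    rcases hαβ.eq_or_lt with rfl | hlt
    · exact le_rfl
    · exact (power_le_power_right (hh.mono hαβ)).trans
        (power_le_power_left (h0 β (not_isMin_of_lt hlt)) (mk_le_mk_of_subset (Iio_subset_Iio hαβ)))
  cofinal μ hμ := by
    obtain ⟨α, hα⟩ := hh.cofinal μ hμ
    exact ⟨Order.succ α, (hα.trans (hh.mono (Order.le_succ α))).trans
      (self_le_power _ (one_le_mk_Iio (not_isMin_of_lt (Order.lt_succ α))))⟩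

theorem le_powFun {α : Below κ} (hα : ¬ IsMin α) : h α ≤ powFun h α :=
  self_le_power _ (one_le_mk_Iio hα)

theorem fusionBound_le_powFun (h0 : ∀ α, ¬ IsMin α → h α ≠ 0) (α : Below κ) :
    fusionBound h α ≤ powFun h α := by
  rw [fusionBound, powFun]
  split_ifs with hα
  · by_cases hmin : IsMin α
    · rw [mk_Iio_of_isMin hmin, power_zero]
    · exact Cardinal.one_le_iff_ne_zero.2 (power_ne_zero _ (h0 α hmin))
  · exact le_rfl

/-- A cardinal function that bounds `h` and the size of the slaloms. -/
noncomputable def sacksBound (h : Below κ → Cardinal.{u}) : Below κ → Cardinal.{u} :=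
  -- A nonzero base gives monotonicity, and the nonempty exponent `Iic α` gives a bound for `h` even
  -- at the least argument.
  fun α => max 2 (h α) ^ #(Iic α)

theorem le_sacksBound (α : Below κ) : h α ≤ sacksBound h α :=
  (le_max_right _ _).trans (self_le_power _ (Cardinal.one_le_iff_ne_zero.2 (mk_ne_zero_iff.2 ⟨⟨α, mem_Iic.2 le_rfl⟩⟩)))

theorem max_two_ne_zero (a : Cardinal.{u}) : max 2 a ≠ 0 := (two_pos.trans_le (le_max_left _ _)).ne'

theorem isCardFun_sacksBound [hκ : Fact κ.IsInaccessible] (hh : IsCardFun h) :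
    IsCardFun (sacksBound h) where
  lt α := power_lt_of_isInaccessible hκ.out (max_lt (hκ.out.nat_lt 2) (hh.lt α)) (mk_Iic_below_lt α)
  mono := fun _ _ hαβ => (power_le_power_right (max_le_max le_rfl (hh.mono hαβ))).trans
    (power_le_power_left (max_two_ne_zero _) (mk_le_mk_of_subset (Iic_subset_Iic.2 hαβ)))
  cofinal μ hμ := by
    obtain ⟨α, hα⟩ := hh.cofinal μ hμ
    exact ⟨α, hα.trans (le_sacksBound α)⟩

theorem fusionBound_le_sacksBound (α : Below κ) : fusionBound h α ≤ sacksBound h α := by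
  rw [fusionBound, sacksBound]
  split_ifs with hα
  · exact Cardinal.one_le_iff_ne_zero.2 (power_ne_zero _ (max_two_ne_zero _))
  · exact (power_le_power_right (le_max_right _ _)).trans
      (power_le_power_left (max_two_ne_zero _) (mk_le_mk_of_subset Iio_subset_Iic_self))

/-! ### The Sacks property and preservation of the successor of `κ` -/

theorem hasSacksProperty [hκ : Fact κ.IsInaccessible] (hh : IsCardFun h) {F : Below κ → Cardinal.{u}}
    (hF : IsCardFun F) (hle : ∀ α, fusionBound h α ≤ F α) : HasSacksProperty (SForcing h) F := by
  intro f p hf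
  have ho : κ.ord ≠ 0 := by
    rw [Ne, ord_eq_zero]
    exact hκ.out.ne_zero
  obtain ⟨φ, hφ, q, hq, hq'⟩ := exists_slalom_of_name hh ho hf (fun ξ => ordName _ ξ)
    (fun ξ => forcesMem_ordName ξ)
  have hφF : ∀ ξ, #(φ ξ) ≤ F ξ := fun ξ => (hφ ξ).trans (hle ξ)
  refine ⟨φ, fun ξ => ⟨(hφF ξ).trans_lt (hF.lt ξ), hφF ξ⟩, q, hq, fun ξ => ?_⟩
  refine forces_ex_iff.2 fun r hr => ?_
  obtain ⟨r', hr', v, hv, hd⟩ := hq' ξ r hr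
  refine ⟨r', hr', ordName _ v, hd, ?_⟩
  exact forcesMem_check_of_mem (PSet.mem_def.2 ⟨⟨v, hv⟩, PSet.Equiv.refl _⟩)

/-- The slalom theorem allows values in any ordinal, so it applies to `f` along a surjection `g`
from κ onto its domain. The union of κ many sets of size less than κ misses some `b` below κ⁺, yet
`b` is forced to have a preimage. -/
theorem preservesCardinal_succ [hκ : Fact κ.IsInaccessible] (hh : IsCardFun h) :
    PreservesCardinal (SForcing h) (Order.succ κ) := by
  intro p q _ hq
  obtain ⟨r₁, -, d, h1⟩ := forces_ex_iff.1 hq q le_rfl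
  obtain ⟨r₂, -, f, hd, hf, honto⟩ := forces_ex_iff.1 h1 r₁ le_rfl
  obtain ⟨r, hr, δ, hδ⟩ := forcesMem_toPSet_iff.1 hd r₂ le_rfl
  obtain ⟨o, ho, hδ⟩ : ∃ o < (Order.succ κ).ord, ForcesEq d (.check (SForcing h) o.toPSet) r :=
    ⟨_, δ.toOrd.2, hδ⟩
  set l := Order.succ κ
  have hl : l.ord ≠ 0 := by
    rw [Ne, ord_eq_zero]
    exact (bot_le.trans_lt (Order.lt_succ κ)).ne'
  have hoκ : #o.ToType ≤ #(Below κ) := by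
    rw [mk_toType, mk_ord_toType, ← Order.lt_succ_iff, ← lt_ord]
    exact ho
  have harg : ∀ {s : SForcing h} {a : PName (SForcing h)} {b : l.ord.ToType}, s ≤ r →
      ForcesMem (.opair a (ordName _ b)) f s → ∃ t ≤ s, ∃ c : o.ToType, ForcesEq a (ordName _ c) t := by
    intro s a b hs hab
    obtain ⟨t, ht, had, -⟩ := hf.exists_mem_of_isFun (hs.trans hr) hab
    obtain ⟨z, hz, c, hc⟩ := forcesMem_toPSet_iff.1
      (ForcesMem.congr_right (hδ.mono (ht.trans hs)) had) t le_rfl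
    exact ⟨z, hz.trans ht, c, hc⟩
  have hpre : ∀ b : l.ord.ToType, ∀ s ≤ r, ∃ t ≤ s, ∃ c : o.ToType,
      ForcesMem (.opair (ordName _ c) (ordName _ b)) f t := by
    intro b s hs
    obtain ⟨t, ht, a, ha⟩ := honto.exists_preimage_of_isOnto (hs.trans hr) (forcesMem_ordName b)
    obtain ⟨z, hz, c, hc⟩ := harg (ht.trans hs) ha
    exact ⟨z, hz.trans ht, c, ForcesMem.congr_left (hc.opair (.refl _ _)) (ha.mono hz)⟩
  obtain ⟨b₀⟩ := Ordinal.nonempty_toType_iff.2 hl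
  obtain ⟨-, -, c₀, -⟩ := hpre b₀ r le_rfl
  obtain ⟨e⟩ := hoκ
  have : Nonempty o.ToType := ⟨c₀⟩
  let g : Below κ → o.ToType := Function.invFun e
  have hg : Function.Surjective g := Function.invFun_surjective e.injective
  obtain ⟨φ, hφ, q', hq', hcov⟩ := exists_slalom_of_name hh hl (Forces.mono hr hf)
    (fun ξ => ordName _ (g ξ))
    (fun ξ => ForcesMem.congr_right hδ.symm (forcesMem_ordName (g ξ)))
  have hunion : #(⋃ ξ, φ ξ) ≤ κ := by
    have hle : ∀ ξ, #(φ ξ) ≤ κ := fun ξ =>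
      ((hφ ξ).trans (fusionBound_le_sacksBound ξ)).trans ((isCardFun_sacksBound hh).lt ξ).le
    refine mk_iUnion_le_sum_mk.trans ((sum_le_sum _ (fun _ => κ) hle).trans_eq ?_)
    rw [sum_const', mk_ord_toType, mul_eq_self hκ.out.1.le]
  obtain ⟨b, hb⟩ : ∃ b : l.ord.ToType, b ∉ ⋃ ξ, φ ξ := by
    by_contra! hcon
    rw [eq_univ_of_forall hcon, mk_univ, mk_ord_toType] at hunion
    exact absurd hunion (not_le_of_gt (Order.lt_succ κ))
  obtain ⟨t, ht, c, hc⟩ := hpre b q' hq'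
  obtain ⟨ξ, rfl⟩ := hg c
  obtain ⟨t', ht', v, hv, hd⟩ := hcov ξ t ht
  obtain ⟨z, hz, he⟩ := (Forces.mono hr hf).exists_forcesEq_of_isFun
    (ht'.trans (ht.trans hq')) (hc.mono ht') hd
  exact hb (mem_iUnion.2 ⟨ξ, eq_of_forcesEq_ordName he ▸ hv⟩)

end TreeForcing
open TreeForcing
theorem mainTheorem3 (κ : Cardinal.{u}) (hκ : κ.IsInaccessible)
    (h : Below κ → Cardinal.{u}) (hh : IsCardFun h) :
    (∃ F : Below κ → Cardinal.{u},
      IsCardFun F ∧ (∀ α, h α ≤ F α) ∧ HasSacksProperty (SForcing h) F) ∧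
    ((∀ α, ¬ IsMin α → h α ≠ 0) →
      IsCardFun (powFun h) ∧ (∀ α, ¬ IsMin α → h α ≤ powFun h α) ∧
        HasSacksProperty (SForcing h) (powFun h)) ∧
    PreservesCardinal (SForcing h) (Order.succ κ) := by
  have : Fact κ.IsInaccessible := ⟨hκ⟩
  exact ⟨⟨sacksBound h, isCardFun_sacksBound hh, le_sacksBound,
      hasSacksProperty hh (isCardFun_sacksBound hh) fusionBound_le_sacksBound⟩,
    fun h0 => ⟨isCardFun_powFun hh h0, fun _ => le_powFun,
      hasSacksProperty hh (isCardFun_powFun hh h0) (fusionBound_le_powFun h0)⟩,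
    preservesCardinal_succ hh⟩
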